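/- **Theorem (Exact manifest transfer function identification for acyclic latent subnetworks, LSAR version).** Consider the linear network $$\begin{bmatrix}x_m(k+1)\\ x_l(k+1)\end{bmatrix}=A\begin{bmatrix}x_m(k)\\ x_l(k)\end{bmatrix}+\begin{bmatrix}u_m(k)\\ 0\end{bmatrix},\qquad A=\begin{bmatrix}A_{11}&A_{12}\\A_{21}&A_{22}\end{bmatrix},\qquad y(k)=x_m(k),\qquad k\ge 0,$$ with $n_m$ manifest and $n_l$ passive latent nodes, real matrices, spectral radii $\rho(A)<1$ and $\rho(A_{22})<1$, and an arbitrary (possibly random) initial state $x(0)$. Let the inputs $u_m(k)\in\mathbb R^{n_m}$ be i.i.d. absolutely continuous random vectors with zero mean and covariance $I_{n_m}$. Let the manifest transfer function $T_{x_mu_m}(\omega)$ be the manifest (upper left) $n_m\times n_m$ block of $(e^{j\omega}I-A)^{-1}$. For $\tau\ge 1$ and $N>\tau$, let $[\hat A_0\ \cdots\ \hat A_{\tau-1}]=\vec y_N\Phi_N^{+}$ be the (minimum-norm) least-squares auto-regressive (LSAR) estimate of order $\tau$ from the data $y(1),\dots,y(N)$, where $\vec y_N=[y(\tau+1)\ \cdots\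 y(N)]$, $\Phi_N$ has block rows $[y(\tau-i)\ \cdots\ y(N-1-i)]$, $i=0,\dots,\tau-1$, and $(\cdot)^+$ is the Moore–Penrose pseudoinverse. Let $$T_{ye}(\{y\}_1^N,\tau)(\omega)=\Big(zI_{n_m}-\sum_{i=0}^{\tau-1}z^{-i}\hat A_i\Big)^{-1},\qquad z=e^{j\omega},$$ be the transfer function from $e$ to $y$ of the estimated model $y(k+1)=\sum_{i=0}^{\tau-1}\hat A_iy(k-i)+e(k)$. Assume that $A_{22}$ is nilpotent, $A_{22}^{\tau_{22}}=0$ with $\tau_{22}\ge 1$. Then for every $\tau\ge\tau_{22}+1$, $$\operatorname*{plim}_{N\to\infty}T_{ye}(\{y\}_1^N,\tau)=T_{x_mu_m}.$$ That is: the probability that the inverse defining $T_{ye}(\{y\}_1^N,\tau)(\omega)$ exists for all $\omega\in[-\pi,\pi]$ tends to $1$; for each $\omega\in[-\pi,\pi]$, every entry of $T_{ye}(\{y\}_1^N,\tau)(\omega)$ converges in probability to the corresponding entry of $T_{x_mu_m}(\omega)$; and $\|T_{ye}(\{y\}_1^N,\tau)-T_{x_mu_m}\|_\infty\to 0$ in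 probability, where $\|T\|_\infty=\sup_{-\pi\le\omega\le\pi}\|T(\omega)\|$ with the spectral norm. -/

import Mathlib

open MeasureTheory ProbabilityTheory Filter Topology
open scoped Matrix ENNReal

noncomputable section

namespace LSAR

/-! ### Moore-Penrose pseudoinverse of a real matrix -/

/-- `X` satisfies the four Penrose equations for `M`, i.e. `X` is the Moore-Penrose
pseudoinverse of the real matrix `M`. -/
def IsMoorePenrose {p q : Type*} [Fintype p] [Fintype q]
    (M : Matrix p q ℝ) (X : Matrix q p ℝ) : Prop :=
  M * X * M = M ∧ X * M * X = X ∧ (M * X)ᵀ = M * X ∧ (X * M)ᵀ = X * M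

theorem exists_isMoorePenrose {p q : Type*} [Fintype p] [Fintype q]
    (M : Matrix p q ℝ) : ∃ X, IsMoorePenrose M X := by
  classical
  have hH : (M * Mᵀ).IsHermitian := by
    simp [Matrix.IsHermitian, Matrix.conjTranspose_eq_transpose_of_trivial]
  obtain ⟨K, h1, h2, h3, h4⟩ : ∃ K : Matrix p p ℝ, (M * Mᵀ) * K * (M * Mᵀ) = M * Mᵀ ∧
      K * (M * Mᵀ) * K = K ∧ Kᵀ = K ∧ (M * Mᵀ) * K = K * (M * Mᵀ) := by
    generalize M * Mᵀ = H at hH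
    obtain ⟨U, d, hU, hd⟩ : ∃ (U : Matrix p p ℝ) (d : p → ℝ), Uᵀ * U = 1 ∧
        H = U * Matrix.diagonal d * Uᵀ := by
      refine ⟨hH.eigenvectorUnitary, hH.eigenvalues, ?_, ?_⟩
      · have := Unitary.coe_star_mul_self hH.eigenvectorUnitary
        simpa [Matrix.star_eq_conjTranspose,
          Matrix.conjTranspose_eq_transpose_of_trivial] using this
      · have := hH.spectral_theorem
        simpa [Unitary.conjStarAlgAut_apply, Matrix.star_eq_conjTranspose, Function.comp_def,
          Matrix.conjTranspose_eq_transpose_of_trivial] using this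
    have key : ∀ a b : p → ℝ, (U * Matrix.diagonal a * Uᵀ) * (U * Matrix.diagonal b * Uᵀ) =
        U * Matrix.diagonal (fun i => a i * b i) * Uᵀ := by
      intro a b
      calc (U * Matrix.diagonal a * Uᵀ) * (U * Matrix.diagonal b * Uᵀ)
          = U * Matrix.diagonal a * (Uᵀ * U) * Matrix.diagonal b * Uᵀ := by
            simp only [Matrix.mul_assoc]
        _ = _ := by rw [hU, Matrix.mul_one, Matrix.mul_assoc U, Matrix.diagonal_mul_diagonal]
    refine ⟨U * Matrix.diagonal (fun i => (d i)⁻¹) * Uᵀ, ?_, ?_, ?_, ?_⟩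
    · rw [hd, key, key]
      simp only [mul_inv_mul_cancel]
    · rw [hd, key, key]
      have h : (fun i => (d i)⁻¹ * d i * (d i)⁻¹) = fun i => (d i)⁻¹ := by
        funext i
        simpa using mul_inv_mul_cancel (d i)⁻¹
      rw [h]
    · simp [Matrix.mul_assoc]
    · rw [hd, key, key]; simp [mul_comm]
  have hz : M * (Mᵀ * K) * M = M := by
    have h0 : (M * Mᵀ * K - 1) * M = 0 := by
      have : ((M * Mᵀ * K - 1) * M) * ((M * Mᵀ * K - 1) * M)ᵀ = 0 := by
        rw [Matrix.transpose_mul, Matrix.mul_assoc, ← Matrix.mul_assoc M, ← Matrix.mul_assoc,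
          Matrix.sub_mul, h1, Matrix.one_mul, sub_self, Matrix.zero_mul]
      rw [← Matrix.conjTranspose_eq_transpose_of_trivial] at this
      exact Matrix.self_mul_conjTranspose_eq_zero.mp this
    rw [Matrix.sub_mul, Matrix.one_mul, sub_eq_zero] at h0
    rw [← Matrix.mul_assoc]; exact h0
  refine ⟨Mᵀ * K, hz, ?_, ?_, ?_⟩
  · have : Mᵀ * K * M * (Mᵀ * K) = Mᵀ * (K * (M * Mᵀ) * K) := by simp only [Matrix.mul_assoc]
    rw [this, h2]
  · rw [← Matrix.mul_assoc, Matrix.transpose_mul, h3, h4]; simp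
  · simp [h3, Matrix.mul_assoc]

/-- The Moore-Penrose pseudoinverse of a real matrix. -/
def pinv {p q : Type*} [Fintype p] [Fintype q] (M : Matrix p q ℝ) : Matrix q p ℝ :=
  Classical.choose (exists_isMoorePenrose M)

theorem pinv_spec {p q : Type*} [Fintype p] [Fintype q] (M : Matrix p q ℝ) :
    IsMoorePenrose M (pinv M) :=
  Classical.choose_spec (exists_isMoorePenrose M)

/-! ### The network with manifest nodes `Fin nm` and passive latent nodes `Fin nl` -/

/-- A real square matrix is Schur stable if its (complex) spectral radius is less than `1`. -/
def SchurStable {ι : Type*} [Fintype ι] [DecidableEq ι] (M : Matrix ι ι ℝ) : Prop :=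
  spectralRadius ℂ (M.map (algebraMap ℝ ℂ)) < 1

/-- State `x(k)` of the network `x(k+1) = A x(k) + [u_m(k); 0]` with initial state `x₀`. -/
def state {nm nl : ℕ} (A : Matrix (Fin nm ⊕ Fin nl) (Fin nm ⊕ Fin nl) ℝ)
    (x₀ : Fin nm ⊕ Fin nl → ℝ) (um : ℕ → Fin nm → ℝ) : ℕ → Fin nm ⊕ Fin nl → ℝ
  | 0 => x₀
  | k + 1 => A *ᵥ state A x₀ um k + Sum.elim (um k) 0

/-- Measured output `y(k) = x_m(k)`. -/
def output {nm nl : ℕ} (A : Matrix (Fin nm ⊕ Fin nl) (Fin nm ⊕ Fin nl) ℝ)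
    (x₀ : Fin nm ⊕ Fin nl → ℝ) (um : ℕ → Fin nm → ℝ) (k : ℕ) : Fin nm → ℝ :=
  fun i => state A x₀ um k (Sum.inl i)

/-- The input is a sequence of i.i.d., absolutely continuous, square integrable random vectors
with zero mean and identity covariance. -/
structure IsWhiteInput {Ω : Type*} [MeasurableSpace Ω] (P : Measure Ω) {nm : ℕ}
    (um : ℕ → Ω → Fin nm → ℝ) : Prop where
  measurable : ∀ k, Measurable (um k)
  indep : iIndepFun um P
  identDistrib : ∀ k, IdentDistrib (um k) (um 0) P P
  absolutelyContinuous : ∀ k, P.map (um k) ≪ volume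
  memLp : ∀ k i, MemLp (fun s => um k s i) 2 P
  mean : ∀ k i, ∫ s, um k s i ∂P = 0
  cov : ∀ k i j, covariance (fun s => um k s i) (fun s => um k s j) P =
    (1 : Matrix (Fin nm) (Fin nm) ℝ) i j

/-! ### Least-squares auto-regressive estimation -/

/-- The matrix `[y(τ+1) y(τ+2) ⋯ y(N)]`. -/
def yMat {nm : ℕ} (τ N : ℕ) (y : ℕ → Fin nm → ℝ) : Matrix (Fin nm) (Fin (N - τ)) ℝ :=
  Matrix.of fun a c => y (τ + 1 + c) a

/-- The regressor matrix `Φ_N`: its block row `i ∈ {0, …, τ-1}` is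
`[y(τ-i) y(τ-i+1) ⋯ y(N-1-i)]`. -/
def regressor {nm : ℕ} (τ N : ℕ) (y : ℕ → Fin nm → ℝ) :
    Matrix (Fin τ × Fin nm) (Fin (N - τ)) ℝ :=
  Matrix.of fun r c => y (τ + c - r.1) r.2

/-- The LSAR estimate `[Â₀ Â₁ ⋯ Â_{τ-1}]`, the minimum-norm least-squares solution
`[y(τ+1) ⋯ y(N)] Φ_N⁺`. -/
def lsar {nm : ℕ} (τ N : ℕ) (y : ℕ → Fin nm → ℝ) : Matrix (Fin nm) (Fin τ × Fin nm) ℝ :=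
  yMat τ N y * pinv (regressor τ N y)

/-- The block `Âᵢ` of the LSAR estimate. -/
def lsarCoeff {nm : ℕ} (τ N : ℕ) (y : ℕ → Fin nm → ℝ) (i : Fin τ) :
    Matrix (Fin nm) (Fin nm) ℝ :=
  Matrix.of fun a b => lsar τ N y a (i, b)

/-! ### Transfer functions on the unit circle -/

/-- The point `z = e^{jθ}`. -/
def zPoint (θ : ℝ) : ℂ := Complex.exp (Complex.I * θ)

/-- The manifest transfer function `T_{x_m u_m}(θ)`: the manifest block of the transfer function
`(zI - A)⁻¹` of the whole network. -/
def manifestTF {nm nl : ℕ} (A : Matrix (Fin nm ⊕ Fin nl) (Fin nm ⊕ Fin nl) ℝ) (θ : ℝ) :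
    Matrix (Fin nm) (Fin nm) ℂ :=
  ((zPoint θ • (1 : Matrix (Fin nm ⊕ Fin nl) (Fin nm ⊕ Fin nl) ℂ) -
    A.map (algebraMap ℝ ℂ))⁻¹).toBlocks₁₁

/-- The matrix `zI - ∑_{i<τ} z^{-i} Bᵢ` at `z = e^{jθ}`. -/
def arChar {nm τ : ℕ} (B : Fin τ → Matrix (Fin nm) (Fin nm) ℝ) (θ : ℝ) :
    Matrix (Fin nm) (Fin nm) ℂ :=
  zPoint θ • (1 : Matrix (Fin nm) (Fin nm) ℂ) -
    ∑ i : Fin τ, (zPoint θ ^ (i : ℕ))⁻¹ • (B i).map (algebraMap ℝ ℂ)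

/-- Transfer function from `e` to `y` of the auto-regressive model
`y(k+1) = ∑_{i<τ} Bᵢ y(k-i) + e(k)`. -/
def arTF {nm τ : ℕ} (B : Fin τ → Matrix (Fin nm) (Fin nm) ℝ) (θ : ℝ) :
    Matrix (Fin nm) (Fin nm) ℂ :=
  (arChar B θ)⁻¹

open scoped Matrix.Norms.L2Operator in
/-- The `H_∞`-norm `sup_{-π ≤ θ ≤ π} ‖T(θ)‖` (spectral norm), with value `∞` if unbounded. -/
def hInfNorm {nm : ℕ} (T : ℝ → Matrix (Fin nm) (Fin nm) ℂ) : ℝ≥0∞ :=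
  ⨆ θ ∈ Set.Icc (-Real.pi) Real.pi, ‖T θ‖ₑ

end LSAR

end

noncomputable section

namespace LSAR

/-! ### Convergence in probability as convergence along a filter -/

/-! Nilpotency of `A₂₂` lets the latent state be eliminated in finitely many steps: the output obeys
an exact auto-regression of order `τ` with coefficients `A₁₁, A₁₂ A₂₂ʲ A₂₁` and innovation `u_m`
(`output_autoRegression`). The transfer function of this model is the inverse of the Schur
complement of the latent block in `zI - A`, that is, `manifestTF`. It remains to show that least
squares is consistent and that inversion is continuous uniformly on the unit circle.

For consistency, the normal equations equate the empirical Gram form of the estimation error with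
the empirical correlation of innovation and regressor. That correlation tends to zero because
`u_m(k)` is independent of the forced response up to time `k`, while the free response dies out. The
Gram form is bounded below without any stationary covariance: `φ(k+1) · v = φ(k) · Hv + u(k) · Kv`
yields `G(Hv) + ‖Kv‖² ≤ G(v) + o(1)‖v‖²`, and observability of `(H, K)` concludes
(`exists_eventually_sq_norm_le`).

Convergence in probability is encoded as convergence along the filter `inProb`, so the least-squares
argument is deterministic and valid along any filter. -/

/-- The sets of pairs `(N, s)` whose sections have probability tending to one. -/
def inProb {Ω : Type*} [MeasurableSpace Ω] (P : Measure Ω) : Filter (ℕ × Ω) where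
  sets := {S | Tendsto (fun N => P {s | (N, s) ∉ S}) atTop (𝓝 0)}
  univ_sets := by simp
  sets_of_superset {S T} hS hST := tendsto_of_tendsto_of_tendsto_of_le_of_le tendsto_const_nhds hS
    (fun _ => zero_le) fun _ => measure_mono fun _ hs h => hs (hST h)
  inter_sets {S T} hS hT := by
    have h := Tendsto.add hS hT
    rw [add_zero] at h
    refine tendsto_of_tendsto_of_tendsto_of_le_of_le tendsto_const_nhds h (fun _ => zero_le)
      fun N => (measure_mono ?_).trans (measure_union_le _ _)
    intro s hs
    exact not_and_or.1 hs

theorem eventually_inProb {Ω : Type*} [MeasurableSpace Ω] {P : Measure Ω} {p : ℕ × Ω → Prop} :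
    (∀ᶠ q in inProb P, p q) ↔ Tendsto (fun N => P {s | ¬ p (N, s)}) atTop (𝓝 0) :=
  Iff.rfl

theorem tendsto_inProb_iff {Ω E : Type*} [MeasurableSpace Ω] {P : Measure Ω}
    [PseudoEMetricSpace E] {f : ℕ → Ω → E} {a : E} :
    TendstoInMeasure P f atTop (fun _ => a) ↔
      Tendsto (fun q : ℕ × Ω => f q.1 q.2) (inProb P) (𝓝 a) := by
  simp only [EMetric.tendsto_nhds, eventually_inProb, not_lt, TendstoInMeasure]

/-! ### Lower bounds for quadratic forms -/

/-- Iterating the inequality `m` times bounds `G v` below by `∑ ‖K Hʲ v‖²` up to `O(δ)‖v‖²`. By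
observability this sum is definite, hence at least a fixed multiple of `‖v‖²` in finite dimension.
`G` need not be quadratic. -/
theorem exists_eventually_sq_norm_le {ι V W : Type*} [NormedAddCommGroup V] [NormedSpace ℝ V]
    [FiniteDimensional ℝ V] [NormedAddCommGroup W] [NormedSpace ℝ W] {l : Filter ι}
    (H : V →L[ℝ] V) (K : V →L[ℝ] W) {G : ι → V → ℝ} {δ : ι → ℝ} (hG : ∀ p v, 0 ≤ G p v)
    (hδ : Tendsto δ l (𝓝 0))
    (hstep : ∀ p v, G p (H v) + ‖K v‖ ^ 2 ≤ G p v + δ p * ‖v‖ ^ 2)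
    (m : ℕ) (hobs : ∀ v, (∀ j < m, K ((H ^ j) v) = 0) → v = 0) :
    ∃ c > 0, ∀ᶠ p in l, ∀ v, c * ‖v‖ ^ 2 ≤ G p v := by
  let T : V →ₗ[ℝ] (Fin m → W) := LinearMap.pi fun j => (K ∘L (H ^ (j : ℕ))).toLinearMap
  have hT : Function.Injective T := by
    rw [injective_iff_map_eq_zero]
    intro v hv
    exact hobs v fun j hj => congrFun hv ⟨j, hj⟩
  obtain ⟨κ, hκ, hT⟩ := T.injective_iff_antilipschitz.1 hT
  have hκ' : (0 : ℝ) < κ := hκ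
  have hlow : ∀ v, ‖v‖ ^ 2 ≤ κ ^ 2 * ∑ j ∈ Finset.range m, ‖K ((H ^ j) v)‖ ^ 2 := by
    intro v
    have h1 : ‖v‖ ≤ κ * ‖T v‖ := by
      have := hT.le_mul_dist v 0
      simpa using this
    have h2 : ‖T v‖ ^ 2 ≤ ∑ j ∈ Finset.range m, ‖K ((H ^ j) v)‖ ^ 2 := by
      rw [← Real.le_sqrt (norm_nonneg _) (by positivity), pi_norm_le_iff_of_nonneg (by positivity)]
      intro j
      apply Real.le_sqrt_of_sq_le
      exact Finset.single_le_sum (f := fun j => ‖K ((H ^ j) v)‖ ^ 2) (fun _ _ => by positivity)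
        (Finset.mem_range.2 j.2)
    calc ‖v‖ ^ 2 ≤ (κ * ‖T v‖) ^ 2 := by gcongr
      _ = κ ^ 2 * ‖T v‖ ^ 2 := by ring
      _ ≤ _ := by gcongr
  have hiter : ∀ p v (k : ℕ), G p ((H ^ k) v) + ∑ j ∈ Finset.range k, ‖K ((H ^ j) v)‖ ^ 2 ≤
      G p v + δ p * ∑ j ∈ Finset.range k, ‖(H ^ j) v‖ ^ 2 := by
    intro p v k
    induction k with
    | zero => simp
    | succ k ih =>
      have := hstep p ((H ^ k) v)
      rw [Finset.sum_range_succ, Finset.sum_range_succ, pow_succ' H k]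
      change G p (H ((H ^ k) v)) + _ ≤ _
      linarith
  set C : ℝ := ∑ j ∈ Finset.range m, ‖H ^ j‖ ^ 2
  have hC : ∀ v, ∑ j ∈ Finset.range m, ‖(H ^ j) v‖ ^ 2 ≤ C * ‖v‖ ^ 2 := by
    intro v
    rw [Finset.sum_mul]
    refine Finset.sum_le_sum fun j _ => ?_
    rw [← mul_pow]
    gcongr
    exact (H ^ j).le_opNorm v
  -- Half of the observability constant `κ⁻²` survives; the other half absorbs the error `|δ| C`.
  refine ⟨((κ : ℝ) ^ 2)⁻¹ / 2, by positivity, ?_⟩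
  have hlim : Tendsto (fun p => |δ p| * C) l (𝓝 0) := by
    simpa using hδ.abs.mul_const C
  filter_upwards [hlim.eventually (gt_mem_nhds (show 0 < ((κ : ℝ) ^ 2)⁻¹ / 2 by positivity))]
    with p hp v
  have h1 := hiter p v m
  have h2 := hG p ((H ^ m) v)
  have h3 : ((κ : ℝ) ^ 2)⁻¹ * ‖v‖ ^ 2 ≤ ∑ j ∈ Finset.range m, ‖K ((H ^ j) v)‖ ^ 2 := by
    rw [inv_mul_le_iff₀ (by positivity)]
    exact hlow v
  have h4 : δ p * ∑ j ∈ Finset.range m, ‖(H ^ j) v‖ ^ 2 ≤ |δ p| * (C * ‖v‖ ^ 2) :=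
    mul_le_mul (le_abs_self _) (hC v) (by positivity) (abs_nonneg _)
  have h5 := mul_le_mul_of_nonneg_right hp.le (sq_nonneg ‖v‖)
  nlinarith

theorem abs_dotProduct_le {R : Type*} [Fintype R] (x y : R → ℝ) :
    |x ⬝ᵥ y| ≤ (∑ r, |x r|) * ‖y‖ := by
  rw [dotProduct, Finset.sum_mul]
  refine (Finset.abs_sum_le_sum_abs _ _).trans (Finset.sum_le_sum fun r _ => ?_)
  rw [abs_mul]
  gcongr
  exact norm_le_pi_norm y r

theorem abs_dotProduct_mulVec_le {M R : Type*} [Fintype M] [Fintype R] (S : Matrix M R ℝ)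
    (x : M → ℝ) (y : R → ℝ) :
    |x ⬝ᵥ S *ᵥ y| ≤ (∑ a, ∑ r, |S a r|) * (‖x‖ * ‖y‖) := by
  have h : ∀ a, |(S *ᵥ y) a| ≤ (∑ r, |S a r|) * ‖y‖ := fun a => abs_dotProduct_le _ _
  rw [dotProduct_comm]
  refine (abs_dotProduct_le _ _).trans ?_
  calc (∑ a, |(S *ᵥ y) a|) * ‖x‖ ≤ (∑ a, (∑ r, |S a r|) * ‖y‖) * ‖x‖ := by
        gcongr with a; exact h a
    _ = _ := by rw [← Finset.sum_mul]; ring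

theorem sq_norm_le_dotProduct_self {M : Type*} [Fintype M] (x : M → ℝ) : ‖x‖ ^ 2 ≤ x ⬝ᵥ x := by
  have h0 : 0 ≤ x ⬝ᵥ x := by simpa using dotProduct_star_self_nonneg x
  rw [← Real.le_sqrt (norm_nonneg _) h0, pi_norm_le_iff_of_nonneg (by positivity)]
  intro i
  apply Real.le_sqrt_of_sq_le
  rw [Real.norm_eq_abs, sq_abs, sq]
  exact Finset.single_le_sum (f := fun i => x i * x i) (fun _ _ => mul_self_nonneg _)
    (Finset.mem_univ i)

/-! ### Auto-regressive processes and their regressors -/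

/-- The transposed companion matrix of an auto-regressive model, as a linear map: if
`y(k+1) = ∑ Bᵢ y(k-i) + u(k)`, then `φ(k+1) · v = φ(k) · (H v) + u(k) · v₀`. -/
def companion {t nm : ℕ} (B : Fin (t + 1) → Matrix (Fin nm) (Fin nm) ℝ) :
    (Fin (t + 1) × Fin nm → ℝ) →ₗ[ℝ] (Fin (t + 1) × Fin nm → ℝ) where
  toFun v r := Fin.snoc (α := fun _ => ℝ) (fun i : Fin t => v (i.succ, r.2)) 0 r.1 +
    ∑ a, v (0, a) * B r.1 a r.2
  map_add' v w := by
    ext ⟨i, b⟩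
    induction i using Fin.lastCases <;>
      simp [add_mul, Finset.sum_add_distrib, add_add_add_comm]
  map_smul' c v := by
    ext ⟨i, b⟩
    induction i using Fin.lastCases <;>
      simp [Finset.mul_sum, mul_add, mul_assoc]

/-- The projection onto the leading block. -/
def leadBlock (t nm : ℕ) : (Fin (t + 1) × Fin nm → ℝ) →ₗ[ℝ] (Fin nm → ℝ) where
  toFun v a := v (0, a)
  map_add' _ _ := rfl
  map_smul' _ _ := rfl

/-- The vector `φ(k)` of the last `τ` outputs. -/
def lagVec {nm : ℕ} (τ : ℕ) (y : ℕ → Fin nm → ℝ) (k : ℕ) : Fin τ × Fin nm → ℝ :=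
  fun r => y (k - r.1) r.2

theorem lagVec_succ_dotProduct {t nm : ℕ} {B : Fin (t + 1) → Matrix (Fin nm) (Fin nm) ℝ}
    {y u : ℕ → Fin nm → ℝ} {k : ℕ}
    (h : y (k + 1) = ∑ i : Fin (t + 1), B i *ᵥ y (k - i) + u k)
    (v : Fin (t + 1) × Fin nm → ℝ) :
    lagVec (t + 1) y (k + 1) ⬝ᵥ v =
      lagVec (t + 1) y k ⬝ᵥ companion B v + u k ⬝ᵥ leadBlock t nm v := by
  have h1 : lagVec (t + 1) y (k + 1) ⬝ᵥ v =
      ∑ b, y (k + 1) b * v (0, b) + ∑ i : Fin t, ∑ b, y (k - i) b * v (i.succ, b) := by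
    simp [dotProduct, Fintype.sum_prod_type, Fin.sum_univ_succ, lagVec]
  have h2 : lagVec (t + 1) y k ⬝ᵥ companion B v =
      ∑ i : Fin t, ∑ b, y (k - i) b * v (i.succ, b) +
      ∑ i : Fin (t + 1), ∑ b, y (k - i) b * ∑ a, v (0, a) * B i a b := by
    simp only [dotProduct, Fintype.sum_prod_type, lagVec, companion, LinearMap.coe_mk,
      AddHom.coe_mk, mul_add, Finset.sum_add_distrib]
    congr 1
    rw [Fin.sum_univ_castSucc]
    simp
  rw [h1, h2, h, dotProduct]
  simp only [Pi.add_apply, Finset.sum_apply, add_mul, Finset.sum_add_distrib, leadBlock,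
    LinearMap.coe_mk, AddHom.coe_mk, Matrix.mulVec, dotProduct, Finset.sum_mul, Finset.mul_sum]
  have h3 : ∑ x, ∑ i : Fin (t + 1), ∑ b, B i x b * y (k - i) b * v (0, x) =
      ∑ i : Fin (t + 1), ∑ b, ∑ a, y (k - i) b * (v (0, a) * B i a b) := by
    rw [Finset.sum_comm]
    refine Finset.sum_congr rfl fun i _ => ?_
    rw [Finset.sum_comm]
    refine Finset.sum_congr rfl fun b _ => Finset.sum_congr rfl fun a _ => by ring
  rw [h3]
  ring

/-- While the leading blocks of the iterates vanish, `companion B` is a pure block shift, so the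
leading block of the `j`-th iterate is block `j` of `v`. -/
theorem companion_observable {t nm : ℕ} (B : Fin (t + 1) → Matrix (Fin nm) (Fin nm) ℝ)
    (v : Fin (t + 1) × Fin nm → ℝ)
    (h : ∀ j < t + 1, leadBlock t nm ((companion B ^ j) v) = 0) : v = 0 := by
  have key : ∀ j (hj : j < t + 1), ∀ i (hi : i + j < t + 1), ∀ b,
      (companion B ^ j) v (⟨i, by omega⟩, b) = v (⟨i + j, hi⟩, b) := by
    intro j
    induction j with
    | zero => intro _ i hi b; simp
    | succ j ih =>
      intro hj i hi b
      have h0 : ∀ a, (companion B ^ j) v (0, a) = 0 := fun a => congrFun (h j (by omega)) a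
      rw [pow_succ', Module.End.mul_apply]
      generalize hw : (companion B ^ j) v = w at *
      have hcs : (⟨i, by omega⟩ : Fin (t + 1)) = Fin.castSucc (⟨i, by omega⟩ : Fin t) := rfl
      simp only [companion, LinearMap.coe_mk, AddHom.coe_mk, h0, zero_mul,
        Finset.sum_const_zero, add_zero]
      rw [hcs, Fin.snoc_castSucc]
      have := ih (by omega) (i + 1) (by omega) b
      rw [Fin.succ_mk, this]
      congr 3
      omega
  ext ⟨⟨i, hi⟩, b⟩
  have h1 := key i hi 0 (by omega) b
  have h2 := congrFun (h i hi) b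
  simp only [zero_add] at h1
  rw [← h1]
  exact h2

/-- Symmetry of `M⁺M` turns this into the transpose of `M M⁺ M = M`; no rank condition is needed, so
the normal equations hold for every data set. -/
theorem mul_pinv_mul_transpose {p q : Type*} [Fintype p] [Fintype q] (M : Matrix p q ℝ) :
    pinv M * M * Mᵀ = Mᵀ := by
  obtain ⟨h1, -, -, h4⟩ := pinv_spec M
  rw [← h4, ← Matrix.transpose_mul, ← Matrix.mul_assoc, h1]

/-- Normal equations of the least-squares estimate. -/
theorem lsar_mul_regressor {nm : ℕ} (τ N : ℕ) (y : ℕ → Fin nm → ℝ) :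
    lsar τ N y * regressor τ N y * (regressor τ N y)ᵀ = yMat τ N y * (regressor τ N y)ᵀ := by
  rw [lsar, Matrix.mul_assoc, Matrix.mul_assoc, ← Matrix.mul_assoc (pinv _),
    mul_pinv_mul_transpose]

theorem lsar_error_normal_eq {nm τ : ℕ} (N : ℕ) {B : Fin τ → Matrix (Fin nm) (Fin nm) ℝ}
    {y u : ℕ → Fin nm → ℝ}
    (h : ∀ k, τ ≤ k → y (k + 1) = ∑ i : Fin τ, B i *ᵥ y (k - i) + u k) (a : Fin nm)
    (r : Fin τ × Fin nm) :
    ∑ c ∈ Finset.range (N - τ),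
      (lagVec τ y (τ + c) ⬝ᵥ fun r => lsarCoeff τ N y r.1 a r.2 - B r.1 a r.2) *
        lagVec τ y (τ + c) r =
      ∑ c ∈ Finset.range (N - τ), u (τ + c) a * lagVec τ y (τ + c) r := by
  have h1 := congrFun (congrFun (lsar_mul_regressor τ N y) a) r
  rw [Matrix.mul_apply, Matrix.mul_apply] at h1
  rw [Finset.sum_range, Finset.sum_range]
  -- The error applied to the regressor is the fitted residual plus the innovation; the normal
  -- equations then remove the residual.
  have h2 : ∀ c : Fin (N - τ), (lagVec τ y (τ + c) ⬝ᵥ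
      fun r => lsarCoeff τ N y r.1 a r.2 - B r.1 a r.2) =
      (lsar τ N y * regressor τ N y) a c - yMat τ N y a c + u (τ + c) a := by
    intro c
    have h3 : yMat τ N y a c = (∑ i : Fin τ, B i *ᵥ y (τ + c - i) + u (τ + c)) a := by
      rw [← h _ (by omega)]
      simp only [yMat, Matrix.of_apply, add_right_comm]
    rw [h3, Matrix.mul_apply]
    simp only [dotProduct, lagVec, lsarCoeff, Matrix.of_apply, mul_sub, Finset.sum_sub_distrib,
      regressor, Pi.add_apply, Finset.sum_apply, Matrix.mulVec, Fintype.sum_prod_type]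
    have e1 : ∀ i : Fin τ, ∀ b, y (τ + c - i) b * B i a b = B i a b * y (τ + c - i) b :=
      fun _ _ => mul_comm _ _
    have e2 : ∀ i : Fin τ, ∀ b, y (τ + c - i) b * lsar τ N y a (i, b) =
      lsar τ N y a (i, b) * y (τ + c - i) b := fun _ _ => mul_comm _ _
    simp only [e1, e2]
    ring
  simp only [h2, add_mul, sub_mul, Finset.sum_add_distrib, Finset.sum_sub_distrib]
  have h4 : ∀ c : Fin (N - τ), (regressor τ N y)ᵀ c r = lagVec τ y (τ + c) r := fun _ => rfl
  simp only [h4] at h1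
  rw [h1]
  ring

/-! ### Consistency of least squares along a filter -/

theorem sum_mul_dotProduct_eq {M R : Type*} [Fintype M] [Fintype R] (s : Finset ℕ) (d : ℝ)
    (u : ℕ → M → ℝ) (φ : ℕ → R → ℝ) (x : M → ℝ) (w : R → ℝ) :
    (∑ c ∈ s, (u c ⬝ᵥ x) * (φ c ⬝ᵥ w)) / d =
      x ⬝ᵥ (Matrix.of fun a r => (∑ c ∈ s, u c a * φ c r) / d) *ᵥ w := by
  have h : ∀ c, (u c ⬝ᵥ x) * (φ c ⬝ᵥ w) = ∑ a, ∑ r, u c a * x a * (φ c r * w r) := fun c =>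
    Finset.sum_mul_sum _ _ _ _
  simp only [h]
  simp only [dotProduct, Matrix.mulVec, Matrix.of_apply, Finset.sum_div, Finset.sum_mul,
    Finset.mul_sum]
  rw [Finset.sum_comm]
  refine Finset.sum_congr rfl fun a _ => ?_
  rw [Finset.sum_comm]
  refine Finset.sum_congr rfl fun r _ => Finset.sum_congr rfl fun c _ => ?_
  ring

/-- The remainder in the recursive lower bound for the empirical second moments. -/
theorem exists_eventually_empirical_ge {ι : Type*} {l : Filter ι} {nm t : ℕ} {n : ι → ℕ}
    {y u : ι → ℕ → Fin nm → ℝ} {B : Fin (t + 1) → Matrix (Fin nm) (Fin nm) ℝ}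
    (hAR : ∀ p k, t + 1 ≤ k → y p (k + 1) = ∑ i : Fin (t + 1), B i *ᵥ y p (k - i) + u p k)
    (hW : ∀ a b, Tendsto (fun p => (∑ c ∈ Finset.range (n p),
      u p (t + 1 + c) a * u p (t + 1 + c) b) / n p) l (𝓝 ((1 : Matrix (Fin nm) (Fin nm) ℝ) a b)))
    (hS : ∀ a r, Tendsto (fun p => (∑ c ∈ Finset.range (n p),
      u p (t + 1 + c) a * lagVec (t + 1) (y p) (t + 1 + c) r) / n p) l (𝓝 0))
    (hL : ∀ r, Tendsto (fun p => lagVec (t + 1) (y p) (t + 1 + n p) r / √(n p)) l (𝓝 0)) :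
    ∃ c > 0, ∀ᶠ p in l, ∀ v, c * ‖v‖ ^ 2 ≤
      (∑ c ∈ Finset.range (n p), (lagVec (t + 1) (y p) (t + 1 + c) ⬝ᵥ v) ^ 2) / n p := by
  let H := LinearMap.toContinuousLinearMap (companion B)
  let K := LinearMap.toContinuousLinearMap (leadBlock t nm)
  let S : ι → Matrix (Fin nm) (Fin (t + 1) × Fin nm) ℝ := fun p => Matrix.of fun a r =>
    (∑ c ∈ Finset.range (n p),
      u p (t + 1 + c) a * lagVec (t + 1) (y p) (t + 1 + c) r) / n p
  let W : ι → Matrix (Fin nm) (Fin nm) ℝ := fun p => Matrix.of fun a b =>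
    (∑ c ∈ Finset.range (n p), u p (t + 1 + c) a * u p (t + 1 + c) b) / n p
  -- The three errors are the end term of the telescoping, the innovation-regressor correlation, and
  -- the deviation of the empirical innovation covariance from `I`.
  let δ : ι → ℝ := fun p => (∑ r, |lagVec (t + 1) (y p) (t + 1 + n p) r / √(n p)|) ^ 2 +
    (2 * (∑ a, ∑ r, |S p a r|) * (‖K‖ * ‖H‖) + (∑ a, ∑ b, |(W p - 1) a b|) * (‖K‖ * ‖K‖))
  refine exists_eventually_sq_norm_le (δ := δ) H K (fun p v => by positivity) ?_ ?_ (t + 1) ?_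
  · have h1 : Tendsto (fun p => ∑ r, |lagVec (t + 1) (y p) (t + 1 + n p) r / √(n p)|) l
        (𝓝 (∑ r : Fin (t + 1) × Fin nm, |(0 : ℝ)|)) :=
      tendsto_finsetSum _ fun r _ => (hL r).abs
    have h2 : Tendsto (fun p => ∑ a, ∑ r, |S p a r|) l
        (𝓝 (∑ a : Fin nm, ∑ r : Fin (t + 1) × Fin nm, |(0 : ℝ)|)) :=
      tendsto_finsetSum _ fun a _ => tendsto_finsetSum _ fun r _ => (hS a r).abs
    have h3 : Tendsto (fun p => ∑ a, ∑ b, |(W p - 1) a b|) l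
        (𝓝 (∑ a : Fin nm, ∑ b : Fin nm, |(1 : Matrix (Fin nm) (Fin nm) ℝ) a b -
          (1 : Matrix (Fin nm) (Fin nm) ℝ) a b|)) :=
      tendsto_finsetSum _ fun a _ => tendsto_finsetSum _ fun b _ => ((hW a b).sub_const _).abs
    simp only [abs_zero, Finset.sum_const_zero, sub_self] at h1 h2 h3
    have h4 := (h1.pow 2).add (((h2.const_mul 2).mul_const (‖K‖ * ‖H‖)).add
      (h3.mul_const (‖K‖ * ‖K‖)))
    rwa [show (0 : ℝ) ^ 2 + (2 * 0 * (‖K‖ * ‖H‖) + 0 * (‖K‖ * ‖K‖)) = 0 by ring] at h4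
  · intro p v
    have hH : ‖H v‖ ≤ ‖H‖ * ‖v‖ := H.le_opNorm v
    have hK : ‖K v‖ ≤ ‖K‖ * ‖v‖ := K.le_opNorm v
    set φ := fun c => lagVec (t + 1) (y p) (t + 1 + c) with hφ
    have hrec : ∀ c, φ (c + 1) ⬝ᵥ v = φ c ⬝ᵥ H v + u p (t + 1 + c) ⬝ᵥ K v := fun c =>
      lagVec_succ_dotProduct (hAR p (t + 1 + c) (by omega)) v
    -- Shifting the sum by one gains the last square and loses the first, which has the favourable
    -- sign.
    have htel : ∑ c ∈ Finset.range (n p), (φ (c + 1) ⬝ᵥ v) ^ 2 ≤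
        ∑ c ∈ Finset.range (n p), (φ c ⬝ᵥ v) ^ 2 + (φ (n p) ⬝ᵥ v) ^ 2 := by
      rw [← Finset.sum_range_succ, Finset.sum_range_succ' (fun c => (φ c ⬝ᵥ v) ^ 2)]
      linarith [sq_nonneg (φ 0 ⬝ᵥ v)]
    have hexp : ∑ c ∈ Finset.range (n p), (φ (c + 1) ⬝ᵥ v) ^ 2 =
        ∑ c ∈ Finset.range (n p), (φ c ⬝ᵥ H v) ^ 2 +
        2 * ∑ c ∈ Finset.range (n p), (u p (t + 1 + c) ⬝ᵥ K v) * (φ c ⬝ᵥ H v) +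
        ∑ c ∈ Finset.range (n p), (u p (t + 1 + c) ⬝ᵥ K v) * (u p (t + 1 + c) ⬝ᵥ K v) := by
      rw [Finset.mul_sum, ← Finset.sum_add_distrib, ← Finset.sum_add_distrib]
      refine Finset.sum_congr rfl fun c _ => ?_
      rw [hrec]
      ring
    rw [hexp] at htel
    have hdiv := div_le_div_of_nonneg_right htel (Nat.cast_nonneg (α := ℝ) (n p))
    rw [add_div, add_div, add_div, mul_div_assoc, sum_mul_dotProduct_eq (u := fun c =>
      u p (t + 1 + c)), sum_mul_dotProduct_eq (u := fun c => u p (t + 1 + c))] at hdiv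
    have hcross : -((∑ a, ∑ r, |S p a r|) * (‖K‖ * ‖H‖) * ‖v‖ ^ 2) ≤ K v ⬝ᵥ S p *ᵥ H v := by
      have h1 := neg_le_of_abs_le (abs_dotProduct_mulVec_le (S p) (K v) (H v))
      refine le_trans (neg_le_neg ?_) h1
      rw [mul_assoc]
      refine mul_le_mul_of_nonneg_left ?_ (by positivity)
      calc ‖K v‖ * ‖H v‖ ≤ (‖K‖ * ‖v‖) * (‖H‖ * ‖v‖) := by gcongr
        _ = _ := by ring
    have hcov : ‖K v‖ ^ 2 - (∑ a, ∑ b, |(W p - 1) a b|) * (‖K‖ * ‖K‖) * ‖v‖ ^ 2 ≤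
        K v ⬝ᵥ W p *ᵥ K v := by
      have h1 := neg_le_of_abs_le (abs_dotProduct_mulVec_le (W p - 1) (K v) (K v))
      rw [Matrix.sub_mulVec, dotProduct_sub, Matrix.one_mulVec] at h1
      have h2 := sq_norm_le_dotProduct_self (K v)
      have h3 : (∑ a, ∑ b, |(W p - 1) a b|) * (‖K v‖ * ‖K v‖) ≤
          (∑ a, ∑ b, |(W p - 1) a b|) * (‖K‖ * ‖K‖) * ‖v‖ ^ 2 := by
        rw [mul_assoc]
        refine mul_le_mul_of_nonneg_left ?_ (by positivity)
        calc ‖K v‖ * ‖K v‖ ≤ (‖K‖ * ‖v‖) * (‖K‖ * ‖v‖) := by gcongr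
          _ = _ := by ring
      linarith
    have hlast : (φ (n p) ⬝ᵥ v) ^ 2 / n p ≤
        (∑ r, |lagVec (t + 1) (y p) (t + 1 + n p) r / √(n p)|) ^ 2 * ‖v‖ ^ 2 := by
      have h1 : (φ (n p) ⬝ᵥ v) ^ 2 / n p =
          ((fun r => lagVec (t + 1) (y p) (t + 1 + n p) r / √(n p)) ⬝ᵥ v) ^ 2 := by
        have : (fun r => lagVec (t + 1) (y p) (t + 1 + n p) r / √(n p)) = (√(n p))⁻¹ • φ (n p) := by
          ext r
          simp [hφ, div_eq_inv_mul]
        rw [this, smul_dotProduct, smul_eq_mul, mul_pow, inv_pow,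
          Real.sq_sqrt (Nat.cast_nonneg _), div_eq_inv_mul]
      rw [h1, ← sq_abs, ← mul_pow]
      gcongr
      exact abs_dotProduct_le _ _
    simp only [δ]
    simp only [S, W] at hcross hcov ⊢
    linarith
  · intro v hv
    refine companion_observable B v fun j hj => ?_
    have h1 : ∀ j w, (H ^ j) w = (companion B ^ j) w := by
      intro j
      induction j with
      | zero => intro w; rfl
      | succ j ih =>
        intro w
        rw [pow_succ, pow_succ, Module.End.mul_apply, ← ih]
        rfl
    rw [← h1]
    exact hv j hj

/-- For each row error `d`, coercivity and the normal equations give `c‖d‖² ≤ s · d ≤ (∑|s_r|)‖d‖`,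
where `s` is the innovation-regressor correlation tending to zero. -/
theorem tendsto_lsarCoeff {ι : Type*} {l : Filter ι} {nm τ : ℕ} (hτ : 0 < τ) {N : ι → ℕ}
    {y u : ι → ℕ → Fin nm → ℝ} {B : Fin τ → Matrix (Fin nm) (Fin nm) ℝ}
    (hAR : ∀ p k, τ ≤ k → y p (k + 1) = ∑ i : Fin τ, B i *ᵥ y p (k - i) + u p k)
    (hW : ∀ a b, Tendsto (fun p => (∑ c ∈ Finset.range (N p - τ),
      u p (τ + c) a * u p (τ + c) b) / (N p - τ : ℕ)) l
        (𝓝 ((1 : Matrix (Fin nm) (Fin nm) ℝ) a b)))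
    (hS : ∀ a r, Tendsto (fun p => (∑ c ∈ Finset.range (N p - τ),
      u p (τ + c) a * lagVec τ (y p) (τ + c) r) / (N p - τ : ℕ)) l (𝓝 0))
    (hL : ∀ r, Tendsto (fun p => lagVec τ (y p) (τ + (N p - τ)) r / √(N p - τ : ℕ)) l (𝓝 0)) :
    Tendsto (fun p => lsarCoeff τ (N p) (y p)) l (𝓝 B) := by
  obtain ⟨t, rfl⟩ := Nat.exists_eq_succ_of_ne_zero hτ.ne'
  obtain ⟨c, hc, hlow⟩ := exists_eventually_empirical_ge hAR hW hS hL
  let d : Fin nm → ι → Fin (t + 1) × Fin nm → ℝ := fun a p r =>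
    lsarCoeff (t + 1) (N p) (y p) r.1 a r.2 - B r.1 a r.2
  have hd : ∀ a, Tendsto (fun p => ‖d a p‖) l (𝓝 0) := by
    intro a
    have hs : Tendsto (fun p => (∑ r, |(∑ c ∈ Finset.range (N p - (t + 1)),
        u p (t + 1 + c) a * lagVec (t + 1) (y p) (t + 1 + c) r) / (N p - (t + 1) : ℕ)|) / c) l
        (𝓝 ((∑ r : Fin (t + 1) × Fin nm, |(0 : ℝ)|) / c)) :=
      (tendsto_finsetSum _ fun r _ => (hS a r).abs).div_const c
    simp only [abs_zero, Finset.sum_const_zero, zero_div] at hs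
    refine squeeze_zero' (Eventually.of_forall fun _ => norm_nonneg _) ?_ hs
    filter_upwards [hlow] with p hp
    have h1 := hp (d a p)
    have h2 : (∑ c ∈ Finset.range (N p - (t + 1)),
        (lagVec (t + 1) (y p) (t + 1 + c) ⬝ᵥ d a p) ^ 2) / (N p - (t + 1) : ℕ) =
        (fun r => (∑ c ∈ Finset.range (N p - (t + 1)),
          u p (t + 1 + c) a * lagVec (t + 1) (y p) (t + 1 + c) r) / (N p - (t + 1) : ℕ)) ⬝ᵥ
            d a p := by
      simp only [← lsar_error_normal_eq (N p) (hAR p) a]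
      simp only [dotProduct, Finset.sum_div, Finset.sum_mul, sq, Finset.mul_sum]
      rw [Finset.sum_comm]
      refine Finset.sum_congr rfl fun r _ => ?_
      refine Finset.sum_congr rfl fun k _ => ?_
      refine Finset.sum_congr rfl fun r' _ => ?_
      simp only [d]
      ring
    rw [h2] at h1
    have h3 := h1.trans ((le_abs_self _).trans (abs_dotProduct_le _ _))
    rw [le_div_iff₀ hc]
    rcases (norm_nonneg (d a p)).eq_or_lt with h0 | h0
    · rw [← h0, zero_mul]
      positivity
    · refine le_of_mul_le_mul_right ?_ h0
      calc ‖d a p‖ * c * ‖d a p‖ = c * ‖d a p‖ ^ 2 := by ring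
        _ ≤ _ := h3
  refine tendsto_pi_nhds.2 fun i => tendsto_pi_nhds.2 fun a => tendsto_pi_nhds.2 fun b => ?_
  rw [tendsto_iff_norm_sub_tendsto_zero]
  exact squeeze_zero (fun _ => norm_nonneg _) (fun p => norm_le_pi_norm (d a p) (i, b)) (hd a)

/-! ### Auto-regressive form of a network with nilpotent latent block -/

/-- The coefficients `A₁₁, A₁₂ A₂₁, A₁₂ A₂₂ A₂₁, …` of the manifest auto-regressive model. -/
def manifestCoeff {nm nl : ℕ} (A : Matrix (Fin nm ⊕ Fin nl) (Fin nm ⊕ Fin nl) ℝ) :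
    ℕ → Matrix (Fin nm) (Fin nm) ℝ
  | 0 => A.toBlocks₁₁
  | j + 1 => A.toBlocks₁₂ * A.toBlocks₂₂ ^ j * A.toBlocks₂₁

section AutoRegression

variable {nm nl : ℕ} (A : Matrix (Fin nm ⊕ Fin nl) (Fin nm ⊕ Fin nl) ℝ)
  (x₀ : Fin nm ⊕ Fin nl → ℝ) (u : ℕ → Fin nm → ℝ)

/-- The latent part `x_l(k)` of the state. -/
def latent (k : ℕ) : Fin nl → ℝ := fun i => state A x₀ u k (Sum.inr i)

theorem output_succ (k : ℕ) : output A x₀ u (k + 1) =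
    A.toBlocks₁₁ *ᵥ output A x₀ u k + A.toBlocks₁₂ *ᵥ latent A x₀ u k + u k := by
  ext i
  simp [output, latent, state, Matrix.mulVec, dotProduct, Matrix.toBlocks₁₁, Matrix.toBlocks₁₂]

theorem latent_succ (k : ℕ) : latent A x₀ u (k + 1) =
    A.toBlocks₂₁ *ᵥ output A x₀ u k + A.toBlocks₂₂ *ᵥ latent A x₀ u k := by
  ext i
  simp [output, latent, state, Matrix.mulVec, dotProduct, Matrix.toBlocks₂₁, Matrix.toBlocks₂₂]

theorem latent_add (k m : ℕ) : latent A x₀ u (k + m) =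
    ∑ j ∈ Finset.range m, (A.toBlocks₂₂ ^ j * A.toBlocks₂₁) *ᵥ output A x₀ u (k + m - (j + 1)) +
      A.toBlocks₂₂ ^ m *ᵥ latent A x₀ u k := by
  induction m with
  | zero => simp
  | succ m ih =>
    rw [← add_assoc, latent_succ, ih, Finset.sum_range_succ', Matrix.mulVec_add,
      Matrix.mulVec_sum, Matrix.mulVec_mulVec, ← pow_succ']
    have h : ∀ j, A.toBlocks₂₂ *ᵥ (A.toBlocks₂₂ ^ j * A.toBlocks₂₁) *ᵥ
        output A x₀ u (k + m - (j + 1)) = (A.toBlocks₂₂ ^ (j + 1) * A.toBlocks₂₁) *ᵥ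
        output A x₀ u (k + m + 1 - (j + 1 + 1)) := by
      intro j
      rw [Matrix.mulVec_mulVec, ← Matrix.mul_assoc, ← pow_succ', Nat.add_sub_add_right]
    simp only [h, pow_zero, Matrix.one_mul, zero_add, Nat.add_sub_cancel]
    abel

theorem output_autoRegression {t : ℕ} (ht : A.toBlocks₂₂ ^ t = 0) {k : ℕ} (hk : t ≤ k) :
    output A x₀ u (k + 1) =
      ∑ i : Fin (t + 1), manifestCoeff A i *ᵥ output A x₀ u (k - i) + u k := by
  -- The latent state is unrolled from `t` steps back, where `A₂₂ ^ t` annihilates it.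
  obtain ⟨k, rfl⟩ := Nat.exists_eq_add_of_le' hk
  rw [output_succ, latent_add, ht, Matrix.zero_mulVec, add_zero, Fin.sum_univ_succ,
    Finset.sum_range, Matrix.mulVec_sum]
  simp [manifestCoeff, Matrix.mul_assoc]

end AutoRegression

/-! ### Transfer functions -/

theorem zPoint_ne_zero (θ : ℝ) : zPoint θ ≠ 0 := Complex.exp_ne_zero _

theorem norm_zPoint (θ : ℝ) : ‖zPoint θ‖ = 1 := by
  rw [zPoint, mul_comm]
  exact Complex.norm_exp_ofReal_mul_I θ

theorem continuous_zPoint : Continuous zPoint := by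
  unfold zPoint
  fun_prop

theorem SchurStable.isUnit_zPoint_smul_sub {ι : Type*} [Fintype ι] [DecidableEq ι]
    {M : Matrix ι ι ℝ} (hM : SchurStable M) (θ : ℝ) :
    IsUnit (zPoint θ • (1 : Matrix ι ι ℂ) - M.map (algebraMap ℝ ℂ)) := by
  have h : zPoint θ ∈ resolventSet ℂ (M.map (algebraMap ℝ ℂ)) := by
    refine spectrum.mem_resolventSet_of_spectralRadius_lt (lt_of_lt_of_eq hM ?_)
    have : ‖zPoint θ‖₊ = 1 := NNReal.eq (norm_zPoint θ)
    simp [this]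
  rw [spectrum.mem_resolventSet_iff, Algebra.algebraMap_eq_smul_one] at h
  exact h

/-- The Neumann series telescopes and stops by nilpotency, so only `z ≠ 0` is required. -/
theorem smul_one_sub_mul_geom_sum {n : Type*} [Fintype n] [DecidableEq n] {D : Matrix n n ℂ}
    {t : ℕ} (hD : D ^ t = 0) {z : ℂ} (hz : z ≠ 0) :
    (z • 1 - D) * ∑ j ∈ Finset.range t, (z ^ (j + 1))⁻¹ • D ^ j = 1 := by
  have h : ∀ j, (z • 1 - D) * ((z ^ (j + 1))⁻¹ • D ^ j) =
      (z ^ j)⁻¹ • D ^ j - (z ^ (j + 1))⁻¹ • D ^ (j + 1) := by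
    intro j
    rw [sub_mul, Matrix.smul_mul, Matrix.one_mul, smul_smul, Matrix.mul_smul, ← pow_succ']
    congr 2
    field_simp
    ring
  rw [Finset.mul_sum]
  simp only [h]
  rw [Finset.sum_range_sub', hD]
  simp

theorem arChar_manifestCoeff {nm nl t : ℕ} (A : Matrix (Fin nm ⊕ Fin nl) (Fin nm ⊕ Fin nl) ℝ)
    (θ : ℝ) : arChar (fun i : Fin (t + 1) => manifestCoeff A i) θ =
      (zPoint θ • 1 - A.toBlocks₁₁.map (algebraMap ℝ ℂ)) -
        (-A.toBlocks₁₂.map (algebraMap ℝ ℂ)) *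
        (∑ j ∈ Finset.range t, (zPoint θ ^ (j + 1))⁻¹ • A.toBlocks₂₂.map (algebraMap ℝ ℂ) ^ j) *
        (-A.toBlocks₂₁.map (algebraMap ℝ ℂ)) := by
  have hneg : ∀ (X : Matrix (Fin nm) (Fin nl) ℂ) (V : Matrix (Fin nl) (Fin nl) ℂ)
      (Y : Matrix (Fin nl) (Fin nm) ℂ), -X * V * -Y = X * V * Y := by
    intro X V Y
    rw [Matrix.neg_mul, Matrix.mul_neg, Matrix.neg_mul, neg_neg]
  rw [hneg, arChar, Fin.sum_univ_succ, Finset.sum_range, ← sub_sub]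
  simp only [Fin.val_zero, pow_zero, inv_one, one_smul, manifestCoeff, Fin.val_succ,
    Matrix.mul_sum, Matrix.sum_mul, Matrix.map_mul, Matrix.map_pow,
    Matrix.mul_smul, Matrix.smul_mul]

/-- `arChar` is the Schur complement of the latent block of `zI - A`. Stability of `A` makes `zI -
A` invertible on the circle; hence so is the complement, and its inverse is the manifest block of
`(zI - A)⁻¹`. -/
theorem isUnit_arChar_and_arTF_eq_manifestTF {nm nl t : ℕ}
    {A : Matrix (Fin nm ⊕ Fin nl) (Fin nm ⊕ Fin nl) ℝ} (hA : SchurStable A)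
    (ht : A.toBlocks₂₂ ^ t = 0) (θ : ℝ) :
    IsUnit (arChar (fun i : Fin (t + 1) => manifestCoeff A i) θ) ∧
      arTF (fun i : Fin (t + 1) => manifestCoeff A i) θ = manifestTF A θ := by
  set V := ∑ j ∈ Finset.range t, (zPoint θ ^ (j + 1))⁻¹ • A.toBlocks₂₂.map (algebraMap ℝ ℂ) ^ j
    with hV
  have hD : A.toBlocks₂₂.map (algebraMap ℝ ℂ) ^ t = 0 := by
    rw [← Matrix.map_pow, ht]
    simp
  have hinv := smul_one_sub_mul_geom_sum hD (zPoint_ne_zero θ)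
  rw [← hV] at hinv
  let iD : Invertible (zPoint θ • 1 - A.toBlocks₂₂.map (algebraMap ℝ ℂ)) :=
    ⟨V, mul_eq_one_comm.1 hinv, hinv⟩
  have hblocks : zPoint θ • (1 : Matrix (Fin nm ⊕ Fin nl) (Fin nm ⊕ Fin nl) ℂ) -
      A.map (algebraMap ℝ ℂ) = Matrix.fromBlocks
        (zPoint θ • 1 - A.toBlocks₁₁.map (algebraMap ℝ ℂ)) (-A.toBlocks₁₂.map (algebraMap ℝ ℂ))
        (-A.toBlocks₂₁.map (algebraMap ℝ ℂ))
        (zPoint θ • 1 - A.toBlocks₂₂.map (algebraMap ℝ ℂ)) := by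
    ext (i | i) (j | j) <;>
      simp [Matrix.toBlocks₁₁, Matrix.toBlocks₁₂, Matrix.toBlocks₂₁, Matrix.toBlocks₂₂,
        Matrix.one_apply]
  have hunit := hA.isUnit_zPoint_smul_sub θ
  have hschur : arChar (fun i : Fin (t + 1) => manifestCoeff A i) θ =
      (zPoint θ • 1 - A.toBlocks₁₁.map (algebraMap ℝ ℂ)) -
        (-A.toBlocks₁₂.map (algebraMap ℝ ℂ)) *
        ⅟(zPoint θ • 1 - A.toBlocks₂₂.map (algebraMap ℝ ℂ)) *
        (-A.toBlocks₂₁.map (algebraMap ℝ ℂ)) := arChar_manifestCoeff A θ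
  rw [hblocks] at hunit
  have hS := Matrix.isUnit_fromBlocks_iff_of_invertible₂₂.1 hunit
  refine ⟨hschur ▸ hS, ?_⟩
  let iS := hS.invertible
  let iM := hunit.invertible
  rw [arTF, manifestTF, hschur, hblocks, ← Matrix.invOf_eq_nonsing_inv,
    ← Matrix.invOf_eq_nonsing_inv, Matrix.invOf_fromBlocks₂₂_eq, Matrix.toBlocks_fromBlocks₁₁]

theorem continuous_arChar {nm τ : ℕ} :
    Continuous fun q : (Fin τ → Matrix (Fin nm) (Fin nm) ℝ) × ℝ => arChar q.1 q.2 := by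
  unfold arChar
  have h1 : Continuous fun q : (Fin τ → Matrix (Fin nm) (Fin nm) ℝ) × ℝ => zPoint q.2 :=
    continuous_zPoint.comp continuous_snd
  refine (h1.smul continuous_const).sub (continuous_finsetSum _ fun i _ => ?_)
  refine ((h1.pow _).inv₀ fun q => pow_ne_zero _ (zPoint_ne_zero _)).smul ?_
  exact ((continuous_apply i).comp continuous_fst).matrix_map (continuous_algebraMap ℝ ℂ)

theorem continuousAt_matrix_inv {n : Type*} [Fintype n] [DecidableEq n] {M : Matrix n n ℂ}
    (hM : IsUnit M) : ContinuousAt (fun X : Matrix n n ℂ => X⁻¹) M := by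
  have h : M.det ≠ 0 := ((Matrix.isUnit_iff_isUnit_det M).1 hM).ne_zero
  simp only [Matrix.inv_def, Ring.inverse_eq_inv']
  have h1 : Continuous fun X : Matrix n n ℂ => X.det := continuous_id.matrix_det
  have h2 : Continuous fun X : Matrix n n ℂ => X.adjugate := continuous_id.matrix_adjugate
  exact (h1.continuousAt.inv₀ h).smul h2.continuousAt

theorem eventually_isUnit_nhds {n : Type*} [Fintype n] [DecidableEq n] {M : Matrix n n ℂ}
    (hM : IsUnit M) : ∀ᶠ X in 𝓝 M, IsUnit X := by
  have h : M.det ≠ 0 := ((Matrix.isUnit_iff_isUnit_det M).1 hM).ne_zero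
  have h1 : Continuous fun X : Matrix n n ℂ => X.det := continuous_id.matrix_det
  filter_upwards [h1.continuousAt.eventually_ne h] with X hX
  exact (Matrix.isUnit_iff_isUnit_det X).2 (isUnit_iff_ne_zero.2 hX)

-- This makes the spectral norm usable as a continuous function for the entrywise topology.
open scoped Matrix.Norms.L2Operator in
theorem continuous_l2_opNorm {n : Type*} [Fintype n] [DecidableEq n] :
    Continuous fun X : Matrix n n ℂ => ‖X‖ :=
  continuous_norm

theorem continuousAt_arTF {nm τ : ℕ} {q : (Fin τ → Matrix (Fin nm) (Fin nm) ℝ) × ℝ}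
    (hq : IsUnit (arChar q.1 q.2)) :
    ContinuousAt (fun q : (Fin τ → Matrix (Fin nm) (Fin nm) ℝ) × ℝ => arTF q.1 q.2) q :=
  ContinuousAt.comp (f := fun q : (Fin τ → Matrix (Fin nm) (Fin nm) ℝ) × ℝ => arChar q.1 q.2)
    (continuousAt_matrix_inv hq) continuous_arChar.continuousAt

/-- Compactness of `K` makes joint continuity at each `(B, θ)` uniform in `θ`. The gauge `g` is the
spectral norm for the `H_∞` claim and zero when only invertibility matters. -/
theorem eventually_arTF_sub_lt {nm τ : ℕ} {B : Fin τ → Matrix (Fin nm) (Fin nm) ℝ}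
    {K : Set ℝ} (hK : IsCompact K) (hB : ∀ θ ∈ K, IsUnit (arChar B θ))
    {g : Matrix (Fin nm) (Fin nm) ℂ → ℝ} (hg : Continuous g) (hg0 : g 0 = 0)
    {ε : ℝ} (hε : 0 < ε) :
    ∀ᶠ C in 𝓝 B, ∀ θ ∈ K, IsUnit (arChar C θ) ∧ g (arTF C θ - arTF B θ) < ε := by
  refine hK.eventually_forall_of_forall_eventually fun θ hθ => ?_
  have h1 : ∀ᶠ q in 𝓝 (B, θ), IsUnit (arChar q.1 q.2) :=
    continuous_arChar.continuousAt.eventually (eventually_isUnit_nhds (hB θ hθ))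
  have h2 : ContinuousAt (fun q : (Fin τ → Matrix (Fin nm) (Fin nm) ℝ) × ℝ =>
      arTF q.1 q.2 - arTF B q.2) (B, θ) := by
    refine (continuousAt_arTF (q := (B, θ)) (hB θ hθ)).sub ?_
    exact ContinuousAt.comp (f := fun q : (Fin τ → Matrix (Fin nm) (Fin nm) ℝ) × ℝ => (B, q.2))
      (x := (B, θ)) (continuousAt_arTF (q := (B, θ)) (hB θ hθ))
      (continuous_const.prodMk continuous_snd).continuousAt
  have h3 : ContinuousAt (fun q : (Fin τ → Matrix (Fin nm) (Fin nm) ℝ) × ℝ =>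
      g (arTF q.1 q.2 - arTF B q.2)) (B, θ) := hg.continuousAt.comp h2
  have h4 := h3.eventually (gt_mem_nhds (show g (arTF B θ - arTF B θ) < ε by simpa [hg0] using hε))
  exact h1.and h4

/-! ### Powers of Schur stable matrices and the solution of the state recursion -/

section Powers

attribute [local instance] Matrix.linftyOpNormedAddCommGroup Matrix.linftyOpNormedRing
  Matrix.linftyOpNormedAlgebra

theorem norm_entry_le_linftyOp {ι : Type*} [Fintype ι] (M : Matrix ι ι ℂ) (i k : ι) :
    ‖M i k‖ ≤ ‖M‖ := by
  have h1 : ∑ j, ‖M i j‖₊ ≤ ‖M‖₊ := by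
    rw [Matrix.linfty_opNNNorm_def]
    exact Finset.le_sup (f := fun i => ∑ j, ‖M i j‖₊) (Finset.mem_univ i)
  have h2 : ‖M i k‖₊ ≤ ∑ j, ‖M i j‖₊ :=
    Finset.single_le_sum (f := fun j => ‖M i j‖₊) (fun _ _ => zero_le) (Finset.mem_univ k)
  exact_mod_cast h2.trans h1

/-- Gelfand's formula: for `r` strictly between the spectral radius and `1`, eventually `‖Mⁿ‖ ≤ rⁿ`,
and the norm dominates every entry. -/
theorem SchurStable.summable_abs_pow {ι : Type*} [Fintype ι] [DecidableEq ι] {M : Matrix ι ι ℝ}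
    (hM : SchurStable M) (i k : ι) : Summable fun j => |(M ^ j) i k| := by
  obtain ⟨r, hr1, hr2⟩ := ENNReal.lt_iff_exists_nnreal_btwn.1 hM
  have hr : (r : ℝ) < 1 := by exact_mod_cast hr2
  have hlim := spectrum.pow_nnnorm_pow_one_div_tendsto_nhds_spectralRadius
    (M.map (algebraMap ℝ ℂ))
  refine (summable_geometric_of_lt_one r.2 hr).of_norm_bounded_eventually_nat ?_
  filter_upwards [hlim.eventually (gt_mem_nhds hr1), eventually_gt_atTop 0] with n hn hn0
  have h1 : (‖M.map (algebraMap ℝ ℂ) ^ n‖₊ : ℝ≥0∞) ≤ r ^ n := by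
    have h2 := ENNReal.rpow_le_rpow hn.le (Nat.cast_nonneg (α := ℝ) n)
    rwa [← ENNReal.rpow_mul, one_div, inv_mul_cancel₀ (by positivity), ENNReal.rpow_one,
      ENNReal.rpow_natCast] at h2
  have h3 : ‖M.map (algebraMap ℝ ℂ) ^ n‖ ≤ (r : ℝ) ^ n := by exact_mod_cast h1
  refine le_trans ?_ h3
  have h4 := norm_entry_le_linftyOp (M.map (algebraMap ℝ ℂ) ^ n) i k
  rw [← Matrix.map_pow] at h4 ⊢
  simpa using h4

end Powers

theorem SchurStable.tendsto_pow_mulVec {ι : Type*} [Fintype ι] [DecidableEq ι]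
    {M : Matrix ι ι ℝ} (hM : SchurStable M) (x : ι → ℝ) (i : ι) :
    Tendsto (fun k => (M ^ k *ᵥ x) i) atTop (𝓝 0) := by
  have h : ∀ j, Tendsto (fun k => (M ^ k) i j * x j) atTop (𝓝 (0 * x j)) := fun j =>
    ((tendsto_zero_iff_abs_tendsto_zero _).2
      (hM.summable_abs_pow i j).tendsto_atTop_zero).mul_const _
  simpa [Matrix.mulVec, dotProduct] using tendsto_finsetSum Finset.univ fun j _ => h j

section State

variable {nm nl : ℕ} (A : Matrix (Fin nm ⊕ Fin nl) (Fin nm ⊕ Fin nl) ℝ)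

/-- Superposition isolates the initial state, which may have no moments and may depend on the
inputs. -/
theorem state_eq_add (x₀ : Fin nm ⊕ Fin nl → ℝ) (u : ℕ → Fin nm → ℝ) (k : ℕ) :
    state A x₀ u k = state A 0 u k + A ^ k *ᵥ x₀ := by
  induction k with
  | zero => simp [state]
  | succ k ih =>
    rw [state, ih, state, Matrix.mulVec_add, Matrix.mulVec_mulVec, ← pow_succ']
    abel

theorem state_zero_eq_sum (u : ℕ → Fin nm → ℝ) (k : ℕ) :
    state A 0 u k = ∑ j ∈ Finset.range k, A ^ j *ᵥ Sum.elim (u (k - (j + 1))) 0 := by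
  induction k with
  | zero => simp [state]
  | succ k ih =>
    rw [state, ih, Finset.sum_range_succ', Matrix.mulVec_sum]
    simp [Matrix.mulVec_mulVec, ← pow_succ']

theorem state_zero_apply (u : ℕ → Fin nm → ℝ) (k : ℕ) (i : Fin nm ⊕ Fin nl) :
    state A 0 u k i = ∑ q ∈ Finset.range k ×ˢ (Finset.univ : Finset (Fin nm)),
      (A ^ q.1) i (Sum.inl q.2) * u (k - (q.1 + 1)) q.2 := by
  rw [state_zero_eq_sum, Finset.sum_apply, Finset.sum_product]
  simp [Matrix.mulVec, dotProduct]

end State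

/-! ### Probabilistic tools -/

/-- The σ-algebra generated by the inputs before time `k`. -/
@[reducible] def past {Ω : Type*} {nm : ℕ} (um : ℕ → Ω → Fin nm → ℝ) (k : ℕ) : MeasurableSpace Ω :=
  ⨆ j ∈ {j | j < k}, MeasurableSpace.comap (um j) inferInstance

theorem past_mono {Ω : Type*} {nm : ℕ} (um : ℕ → Ω → Fin nm → ℝ) : Monotone (past um) :=
  fun _ _ h => biSup_mono fun _ hj => lt_of_lt_of_le hj h

theorem measurable_past {Ω : Type*} {nm : ℕ} (um : ℕ → Ω → Fin nm → ℝ) {j k : ℕ} (h : j < k)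
    (a : Fin nm) : Measurable[past um k] fun s => um j s a := by
  have h1 : MeasurableSpace.comap (um j) inferInstance ≤ past um k :=
    le_iSup₂ (f := fun j (_ : j ∈ {j | j < k}) => MeasurableSpace.comap (um j) inferInstance) j h
  exact ((measurable_pi_apply a).comp (comap_measurable (um j))).mono h1 le_rfl

theorem measurable_past_state {Ω : Type*} {nm nl : ℕ}
    (A : Matrix (Fin nm ⊕ Fin nl) (Fin nm ⊕ Fin nl) ℝ)
    (um : ℕ → Ω → Fin nm → ℝ) (k : ℕ) (i : Fin nm ⊕ Fin nl) :
    Measurable[past um k] fun s => state A 0 (fun j => um j s) k i := by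
  simp only [state_zero_apply]
  refine Finset.measurable_fun_sum _ fun q hq => ?_
  have hq' := Finset.mem_range.1 (Finset.mem_product.1 hq).1
  exact (measurable_past um (by omega) q.2).const_mul _

section Prob

variable {Ω : Type*} [MeasurableSpace Ω] {P : Measure Ω}

theorem tendsto_inProb_sub (τ : ℕ) :
    Tendsto (fun q : ℕ × Ω => (q.1 - τ, q.2)) (inProb P) (inProb P) :=
  fun S hS => Tendsto.comp (f := fun N => N - τ) (g := fun N => P {s | (N, s) ∉ S}) hS
    (tendsto_sub_atTop_nat τ)

theorem tendsto_inProb_of_ae [IsFiniteMeasure P] {f : ℕ → Ω → ℝ} {a : ℝ}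
    (hf : ∀ n, AEStronglyMeasurable (f n) P)
    (h : ∀ᵐ s ∂P, Tendsto (fun n => f n s) atTop (𝓝 a)) :
    Tendsto (fun q : ℕ × Ω => f q.1 q.2) (inProb P) (𝓝 a) :=
  tendsto_inProb_iff.1 (tendstoInMeasure_of_tendsto_ae hf h)

/-- Chebyshev's inequality. -/
theorem tendsto_inProb_of_integral_sq_le [IsFiniteMeasure P] {f : ℕ → Ω → ℝ} {D : ℕ → ℝ}
    (hf : ∀ n, MemLp (f n) 2 P) (h : ∀ n, ∫ s, f n s ^ 2 ∂P ≤ D n)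
    (hD : Tendsto D atTop (𝓝 0)) :
    Tendsto (fun q : ℕ × Ω => f q.1 q.2) (inProb P) (𝓝 0) := by
  rw [Metric.tendsto_nhds]
  intro ε hε
  rw [eventually_inProb]
  have hlim : Tendsto (fun n => ENNReal.ofReal (D n / ε ^ 2)) atTop (𝓝 0) := by
    simpa using ENNReal.tendsto_ofReal (hD.div_const (ε ^ 2))
  refine tendsto_of_tendsto_of_tendsto_of_le_of_le tendsto_const_nhds hlim
    (fun _ => zero_le) fun n => ?_
  have h1 := mul_meas_ge_le_integral_of_nonneg (μ := P) (f := fun s => f n s ^ 2)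
    (Eventually.of_forall fun s => sq_nonneg _) (hf n).integrable_sq (ε ^ 2)
  have h2 : {s | ¬ dist (f n s) 0 < ε} = {s | ε ^ 2 ≤ f n s ^ 2} := by
    ext s
    change ¬ dist (f n s) 0 < ε ↔ ε ^ 2 ≤ f n s ^ 2
    rw [not_lt, Real.dist_0_eq_abs, ← sq_abs (f n s)]
    exact (pow_le_pow_iff_left₀ hε.le (abs_nonneg _) two_ne_zero).symm
  change P {s | ¬ dist (f n s) 0 < ε} ≤ _
  rw [h2, ← ofReal_measureReal]
  refine ENNReal.ofReal_le_ofReal ?_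
  rw [le_div_iff₀ (by positivity), mul_comm]
  exact h1.trans (h n)

/-- The average of orthogonal variables with bounded second moments tends to zero. -/
theorem tendsto_inProb_average_of_orthogonal [IsFiniteMeasure P] {X : ℕ → Ω → ℝ} {C : ℝ}
    (hX : ∀ n, MemLp (X n) 2 P) (horth : ∀ m n, m < n → ∫ s, X m s * X n s ∂P = 0)
    (hC : ∀ n, ∫ s, X n s ^ 2 ∂P ≤ C) :
    Tendsto (fun q : ℕ × Ω => (∑ c ∈ Finset.range q.1, X c q.2) / q.1) (inProb P) (𝓝 0) := by
  have hint : ∀ m n, Integrable (fun s => X m s * X n s) P := fun m n =>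
    (hX m).integrable_mul (hX n)
  have hsq : ∀ n, ∫ s, (∑ c ∈ Finset.range n, X c s) ^ 2 ∂P ≤ n * C := by
    intro n
    simp only [sq, Finset.sum_mul_sum]
    rw [integral_finsetSum _ fun i _ => integrable_finsetSum _ fun j _ => hint i j]
    calc ∑ i ∈ Finset.range n, ∫ s, ∑ j ∈ Finset.range n, X i s * X j s ∂P
        ≤ ∑ i ∈ Finset.range n, C := by
          refine Finset.sum_le_sum fun i hi => ?_
          rw [integral_finsetSum _ fun j _ => hint i j, Finset.sum_eq_single i]
          · simpa only [sq] using hC i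
          · intro j _ hj
            rcases lt_or_gt_of_ne hj with h | h
            · rw [← horth j i h]
              exact integral_congr_ae (Eventually.of_forall fun s => mul_comm _ _)
            · exact horth i j h
          · exact fun h => absurd hi h
      _ = n * C := by simp
  refine tendsto_inProb_of_integral_sq_le (f := fun n s => (∑ c ∈ Finset.range n, X c s) / n)
    (D := fun n => C / n) ?_ ?_ (tendsto_const_div_atTop_nhds_zero_nat C)
  · intro n
    simp only [div_eq_inv_mul]
    exact (memLp_finsetSum _ fun c _ => hX c).const_mul _
  · intro n
    simp only [div_pow]
    rw [integral_div]
    rcases Nat.eq_zero_or_pos n with rfl | hn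
    · simp
    · rw [div_le_div_iff₀ (by positivity) (by positivity)]
      have := hsq n
      have hn' : (0 : ℝ) < n := by positivity
      nlinarith

namespace IsWhiteInput

variable {nm : ℕ} {um : ℕ → Ω → Fin nm → ℝ}

theorem past_le (hum : IsWhiteInput P um) (k : ℕ) : past um k ≤ ‹MeasurableSpace Ω› :=
  iSup₂_le fun j _ => (hum.measurable j).comap_le

theorem indepFun_past (hum : IsWhiteInput P um) {k : ℕ} {f : Ω → ℝ}
    (hf : Measurable[past um k] f) (a : Fin nm) : IndepFun f (fun s => um k s a) P := by
  have h := indep_iSup_of_disjoint (fun j => (hum.measurable j).comap_le)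
    ((iIndepFun_iff_iIndep _ _ _).1 hum.indep) (S := {j | j < k}) (T := {k})
    (Set.disjoint_singleton_right.2 (lt_irrefl k))
  rw [iSup_singleton] at h
  rw [IndepFun_iff_Indep]
  refine indep_of_indep_of_le_left (indep_of_indep_of_le_right h ?_) hf.comap_le
  exact ((measurable_pi_apply a).comp (comap_measurable (um k))).comap_le

theorem integral_mul (hum : IsWhiteInput P um) [IsProbabilityMeasure P] (k : ℕ) (a b : Fin nm) :
    ∫ s, um k s a * um k s b ∂P = (1 : Matrix (Fin nm) (Fin nm) ℝ) a b := by
  have h := hum.cov k a b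
  rw [covariance_eq_sub (hum.memLp k a) (hum.memLp k b), hum.mean, zero_mul, sub_zero] at h
  exact h

theorem integral_sq (hum : IsWhiteInput P um) [IsProbabilityMeasure P] (k : ℕ) (a : Fin nm) :
    ∫ s, um k s a ^ 2 ∂P = 1 := by
  simpa [sq] using hum.integral_mul k a a

theorem tendsto_covariance (hum : IsWhiteInput P um) [IsProbabilityMeasure P] (k : ℕ)
    (a b : Fin nm) :
    Tendsto (fun q : ℕ × Ω => (∑ c ∈ Finset.range q.1, um (k + c) q.2 a * um (k + c) q.2 b) / q.1)
      (inProb P) (𝓝 ((1 : Matrix (Fin nm) (Fin nm) ℝ) a b)) := by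
  have hm : Measurable fun x : Fin nm → ℝ => x a * x b := by fun_prop
  have h := strong_law_ae_real (μ := P) (fun c s => um (k + c) s a * um (k + c) s b)
    ((hum.memLp _ a).integrable_mul (hum.memLp _ b))
    (fun i j hij => (hum.indep.indepFun (show k + i ≠ k + j by omega)).comp hm hm)
    (fun i => ((hum.identDistrib (k + i)).trans (hum.identDistrib (k + 0)).symm).comp hm)
  rw [hum.integral_mul] at h
  refine tendsto_inProb_of_ae
    (f := fun n s => (∑ c ∈ Finset.range n, um (k + c) s a * um (k + c) s b) / n) (fun n => ?_) h
  have := hum.measurable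
  exact Measurable.aestronglyMeasurable (by fun_prop)

/-- Independence factors `E[u² f²] = E[u²] E[f²]`, so second moments suffice. -/
theorem memLp_mul_past (hum : IsWhiteInput P um) [IsProbabilityMeasure P] {k : ℕ} {f : Ω → ℝ}
    (hf : Measurable[past um k] f) (hf2 : MemLp f 2 P) (a : Fin nm) :
    MemLp (fun s => um k s a * f s) 2 P ∧
      ∫ s, (um k s a * f s) ^ 2 ∂P = ∫ s, f s ^ 2 ∂P := by
  have hu : Measurable fun s => um k s a := (measurable_pi_apply a).comp (hum.measurable k)
  have hind : IndepFun (fun s => um k s a ^ 2) (fun s => f s ^ 2) P :=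
    ((hum.indepFun_past hf a).symm).comp (measurable_id.pow_const 2) (measurable_id.pow_const 2)
  have h1 := hind.integrable_mul (hum.memLp k a).integrable_sq hf2.integrable_sq
  have h2 := hind.integral_mul_eq_mul_integral (hum.memLp k a).integrable_sq.1 hf2.integrable_sq.1
  rw [hum.integral_sq, one_mul] at h2
  simp only [Pi.mul_apply] at h2
  refine ⟨?_, ?_⟩
  · refine (memLp_two_iff_integrable_sq (hu.aestronglyMeasurable.mul hf2.1)).2 ?_
    convert! h1 using 2
    exact mul_pow _ _ _
  · simpa only [mul_pow] using h2

theorem tendsto_average_mul_past (hum : IsWhiteInput P um) [IsProbabilityMeasure P] (k : ℕ)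
    {f : ℕ → Ω → ℝ} (hf : ∀ c, Measurable[past um (k + c)] (f c)) (hf2 : ∀ c, MemLp (f c) 2 P)
    {C : ℝ} (hC : ∀ c, ∫ s, f c s ^ 2 ∂P ≤ C) (a : Fin nm) :
    Tendsto (fun q : ℕ × Ω => (∑ c ∈ Finset.range q.1, um (k + c) q.2 a * f c q.2) / q.1)
      (inProb P) (𝓝 0) := by
  refine tendsto_inProb_average_of_orthogonal (X := fun c s => um (k + c) s a * f c s) (C := C)
    (fun c => (hum.memLp_mul_past (hf c) (hf2 c) a).1) ?_
    (fun c => (hum.memLp_mul_past (hf c) (hf2 c) a).2.trans_le (hC c))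
  intro m n hmn
  -- Orthogonality as for martingale differences: every factor but the latest input is determined by
  -- the past, and that input has mean zero.
  have hmeas : Measurable[past um (k + n)] fun s => um (k + m) s a * f m s * f n s :=
    ((measurable_past um (by omega) a).mul
      ((hf m).mono (past_mono um (by omega)) le_rfl)).mul (hf n)
  have h := (hum.indepFun_past hmeas a).integral_mul_eq_mul_integral
    (hmeas.mono (hum.past_le _) le_rfl).aestronglyMeasurable (hum.memLp (k + n) a).1
  rw [hum.mean, mul_zero] at h
  rw [← h]
  refine integral_congr_ae (Eventually.of_forall fun s => ?_)
  simp only [Pi.mul_apply]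
  ring

theorem memLp_state (hum : IsWhiteInput P um) {nl : ℕ}
    (A : Matrix (Fin nm ⊕ Fin nl) (Fin nm ⊕ Fin nl) ℝ) (k : ℕ) (i : Fin nm ⊕ Fin nl) :
    MemLp (fun s => state A 0 (fun j => um j s) k i) 2 P := by
  simp only [state_zero_apply]
  exact memLp_finsetSum _ fun q _ => (hum.memLp _ q.2).const_mul _

/-- Weighted Cauchy-Schwarz, `(∑ a u)² ≤ (∑ |a|)(∑ |a| u²)`, bounds the second moment by `(∑ |a|)²`,
which stability keeps bounded in `k`. -/
theorem exists_integral_sq_state_le (hum : IsWhiteInput P um) [IsProbabilityMeasure P] {nl : ℕ}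
    {A : Matrix (Fin nm ⊕ Fin nl) (Fin nm ⊕ Fin nl) ℝ} (hA : SchurStable A)
    (i : Fin nm ⊕ Fin nl) :
    ∃ C, ∀ k, ∫ s, state A 0 (fun j => um j s) k i ^ 2 ∂P ≤ C := by
  set w : ℕ × Fin nm → ℝ := fun q => |(A ^ q.1) i (Sum.inl q.2)|
  set C := ∑ a, ∑' j, w (j, a)
  have hw : ∀ k, ∑ q ∈ Finset.range k ×ˢ (Finset.univ : Finset (Fin nm)), w q ≤ C := by
    intro k
    rw [Finset.sum_product_right]
    exact Finset.sum_le_sum fun a _ =>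
      (hA.summable_abs_pow i (Sum.inl a)).sum_le_tsum _ fun _ _ => abs_nonneg _
  refine ⟨C * C, fun k => ?_⟩
  set S := Finset.range k ×ˢ (Finset.univ : Finset (Fin nm))
  have hw0 : 0 ≤ ∑ q ∈ S, w q := Finset.sum_nonneg fun _ _ => abs_nonneg _
  have hint : ∀ q, Integrable (fun s => w q * um (k - (q.1 + 1)) s q.2 ^ 2) P := fun q =>
    (hum.memLp _ q.2).integrable_sq.const_mul _
  calc ∫ s, state A 0 (fun j => um j s) k i ^ 2 ∂P
      ≤ ∫ s, (∑ q ∈ S, w q) * ∑ q ∈ S, w q * um (k - (q.1 + 1)) s q.2 ^ 2 ∂P := by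
        refine integral_mono (hum.memLp_state A k i).integrable_sq
          ((integrable_finsetSum _ fun q _ => hint q).const_mul _) fun s => ?_
        simp only [state_zero_apply]
        refine Finset.sum_sq_le_sum_mul_sum_of_sq_le_mul _ (fun _ _ => abs_nonneg _)
          (fun q _ => mul_nonneg (abs_nonneg _) (sq_nonneg _)) fun q _ => ?_
        rw [mul_pow, ← mul_assoc, ← sq, sq_abs]
    _ = (∑ q ∈ S, w q) * ∑ q ∈ S, w q := by
        rw [integral_const_mul, integral_finsetSum _ fun q _ => hint q]
        simp only [integral_const_mul, hum.integral_sq, mul_one]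
    _ ≤ C * C := mul_le_mul (hw k) (hw k) hw0 (hw0.trans (hw k))

end IsWhiteInput

end Prob

/-! ### Consistency of the estimate and of its transfer function -/

section Consistency

variable {Ω : Type*} [MeasurableSpace Ω] {P : Measure Ω} [IsProbabilityMeasure P] {nm nl : ℕ}
  {A : Matrix (Fin nm ⊕ Fin nl) (Fin nm ⊕ Fin nl) ℝ} {um : ℕ → Ω → Fin nm → ℝ}
  {x₀ : Ω → Fin nm ⊕ Fin nl → ℝ}

theorem output_eq_add (x : Fin nm ⊕ Fin nl → ℝ) (u : ℕ → Fin nm → ℝ) (k : ℕ) (b : Fin nm) :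
    output A x u k b = state A 0 u k (Sum.inl b) + (A ^ k *ᵥ x) (Sum.inl b) := by
  rw [output, state_eq_add, Pi.add_apply]

theorem tendsto_add_sub_atTop (τ i : ℕ) : Tendsto (fun c => τ + c - i) atTop atTop :=
  (tendsto_sub_atTop_nat i).comp (tendsto_add_atTop_iff_nat τ |>.2 tendsto_id |>.congr
    fun _ => add_comm _ _)

theorem measurable_free (hx₀ : Measurable x₀) (k : ℕ) (i : Fin nm ⊕ Fin nl) :
    Measurable fun s => (A ^ k *ᵥ x₀ s) i := by
  simp only [Matrix.mulVec, dotProduct]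
  exact Finset.measurable_fun_sum _ fun j _ =>
    ((measurable_pi_apply j).comp hx₀).const_mul _

/-- Independence is unavailable here. Cauchy-Schwarz bounds the average by the root of the mean of
`u²`, which converges, times the Cesàro mean of the squared free response, which vanishes pathwise.
-/
theorem tendsto_cross_free (hA : SchurStable A) (hum : IsWhiteInput P um) (hx₀ : Measurable x₀)
    (τ i : ℕ) (a b : Fin nm) :
    Tendsto (fun q : ℕ × Ω => (∑ c ∈ Finset.range q.1,
      um (τ + c) q.2 a * (A ^ (τ + c - i) *ᵥ x₀ q.2) (Sum.inl b)) / q.1) (inProb P) (𝓝 0) := by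
  have hr : Tendsto (fun q : ℕ × Ω => (q.1 : ℝ)⁻¹ * ∑ c ∈ Finset.range q.1,
      ((A ^ (τ + c - i) *ᵥ x₀ q.2) (Sum.inl b)) ^ 2) (inProb P) (𝓝 0) := by
    refine tendsto_inProb_of_ae (f := fun n s => (n : ℝ)⁻¹ * ∑ c ∈ Finset.range n,
      ((A ^ (τ + c - i) *ᵥ x₀ s) (Sum.inl b)) ^ 2) (fun n => ?_)
      (Eventually.of_forall fun s => ?_)
    · exact ((Finset.measurable_fun_sum _ fun c _ =>
        (measurable_free hx₀ _ _).pow_const 2).const_mul _).aestronglyMeasurable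
    · have h := ((hA.tendsto_pow_mulVec (x₀ s) (Sum.inl b)).comp
        (tendsto_add_sub_atTop τ i)).pow 2
      rw [zero_pow two_ne_zero] at h
      exact h.cesaro
  have h := ((hum.tendsto_covariance τ a a).mul hr).sqrt
  rw [mul_zero, Real.sqrt_zero] at h
  refine squeeze_zero_norm (fun q => ?_) h
  rw [Real.norm_eq_abs, ← Real.sqrt_sq_eq_abs]
  refine Real.sqrt_le_sqrt ?_
  have hcs := Finset.sum_mul_sq_le_sq_mul_sq (Finset.range q.1)
    (fun c => um (τ + c) q.2 a) (fun c => (A ^ (τ + c - i) *ᵥ x₀ q.2) (Sum.inl b))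
  simp only [← sq]
  calc _ ≤ ((∑ c ∈ Finset.range q.1, um (τ + c) q.2 a ^ 2) *
        ∑ c ∈ Finset.range q.1, (A ^ (τ + c - i) *ᵥ x₀ q.2) (Sum.inl b) ^ 2) / (q.1 : ℝ) ^ 2 := by
        rw [div_pow]
        gcongr
    _ = _ := by
        rw [sq (q.1 : ℝ), div_eq_mul_inv, div_eq_mul_inv, mul_inv]
        ring

theorem tendsto_cross_output (hA : SchurStable A) (hum : IsWhiteInput P um)
    (hx₀ : Measurable x₀) (τ i : ℕ) (a b : Fin nm) :
    Tendsto (fun q : ℕ × Ω => (∑ c ∈ Finset.range q.1, um (τ + c) q.2 a *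
      output A (x₀ q.2) (fun j => um j q.2) (τ + c - i) b) / q.1) (inProb P) (𝓝 0) := by
  obtain ⟨C, hC⟩ := hum.exists_integral_sq_state_le hA (Sum.inl b)
  have h1 := hum.tendsto_average_mul_past τ
    (f := fun c s => state A 0 (fun j => um j s) (τ + c - i) (Sum.inl b))
    (fun c => (measurable_past_state A um _ _).mono (past_mono um (Nat.sub_le _ _)) le_rfl)
    (fun c => hum.memLp_state A _ _) (fun c => hC _) a
  have h2 := h1.add (tendsto_cross_free hA hum hx₀ τ i a b)
  rw [add_zero] at h2
  refine h2.congr fun q => ?_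
  simp only [output_eq_add, mul_add, Finset.sum_add_distrib, add_div]

theorem tendsto_output_div_sqrt (hA : SchurStable A) (hum : IsWhiteInput P um)
    (hx₀ : Measurable x₀) (τ i : ℕ) (b : Fin nm) :
    Tendsto (fun q : ℕ × Ω =>
      output A (x₀ q.2) (fun j => um j q.2) (τ + q.1 - i) b / √q.1) (inProb P) (𝓝 0) := by
  obtain ⟨C, hC⟩ := hum.exists_integral_sq_state_le hA (Sum.inl b)
  have h1 : Tendsto (fun q : ℕ × Ω =>
      state A 0 (fun j => um j q.2) (τ + q.1 - i) (Sum.inl b) / √q.1) (inProb P) (𝓝 0) := by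
    refine tendsto_inProb_of_integral_sq_le
      (f := fun n s => state A 0 (fun j => um j s) (τ + n - i) (Sum.inl b) / √n)
      (D := fun n => C / n) (fun n => ?_) (fun n => ?_)
      (tendsto_const_div_atTop_nhds_zero_nat C)
    · simp only [div_eq_inv_mul]
      exact (hum.memLp_state A _ _).const_mul _
    · simp only [div_pow, Real.sq_sqrt (Nat.cast_nonneg (α := ℝ) n)]
      rw [integral_div]
      exact div_le_div_of_nonneg_right (hC _) (Nat.cast_nonneg _)
  have h2 : Tendsto (fun q : ℕ × Ω =>
      (A ^ (τ + q.1 - i) *ᵥ x₀ q.2) (Sum.inl b) / √q.1) (inProb P) (𝓝 0) := by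
    refine tendsto_inProb_of_ae
      (f := fun n s => (A ^ (τ + n - i) *ᵥ x₀ s) (Sum.inl b) / √n)
      (fun n => ((measurable_free hx₀ _ _).div_const _).aestronglyMeasurable)
      (Eventually.of_forall fun s => ?_)
    exact ((hA.tendsto_pow_mulVec (x₀ s) (Sum.inl b)).comp
      (tendsto_add_sub_atTop τ i)).div_atTop
        (Real.tendsto_sqrt_atTop.comp tendsto_natCast_atTop_atTop)
  have h3 := h1.add h2
  rw [add_zero] at h3
  refine h3.congr fun q => ?_
  rw [output_eq_add, add_div]

theorem tendsto_lsarCoeff_inProb (hA : SchurStable A) (hum : IsWhiteInput P um)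
    (hx₀ : Measurable x₀) {t : ℕ} (ht : A.toBlocks₂₂ ^ t = 0) :
    Tendsto (fun q : ℕ × Ω =>
      lsarCoeff (t + 1) q.1 (output A (x₀ q.2) fun k => um k q.2)) (inProb P)
      (𝓝 fun i : Fin (t + 1) => manifestCoeff A i) := by
  refine tendsto_lsarCoeff (N := fun q : ℕ × Ω => q.1) (u := fun q k => um k q.2)
    (y := fun q => output A (x₀ q.2) fun k => um k q.2) t.succ_pos
    (fun q k hk => output_autoRegression A (x₀ q.2) (fun k => um k q.2) ht
      (Nat.le_of_succ_le hk)) (fun a b => ?_) (fun a r => ?_) fun r => ?_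
  · have h := (hum.tendsto_covariance (t + 1) a b).comp (tendsto_inProb_sub (t + 1))
    simpa only [Function.comp_def] using h
  · have h := (tendsto_cross_output hA hum hx₀ (t + 1) r.1 a r.2).comp
      (tendsto_inProb_sub (t + 1))
    simpa only [Function.comp_def, lagVec] using h
  · have h := (tendsto_output_div_sqrt hA hum hx₀ (t + 1) r.1 r.2).comp
      (tendsto_inProb_sub (t + 1))
    simpa only [Function.comp_def, lagVec] using h

end Consistency

open scoped Matrix.Norms.L2Operator in
theorem hInfNorm_lt_of_forall_norm_le {nm : ℕ} {T : ℝ → Matrix (Fin nm) (Fin nm) ℂ} {δ : ℝ}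
    {ε : ℝ≥0∞} (hδ : ENNReal.ofReal δ < ε) (h : ∀ θ ∈ Set.Icc (-Real.pi) Real.pi, ‖T θ‖ ≤ δ) :
    hInfNorm T < ε := by
  refine lt_of_le_of_lt (iSup₂_le fun θ hθ => ?_) hδ
  rw [← ofReal_norm]
  exact ENNReal.ofReal_le_ofReal (h θ hθ)

open scoped Matrix.Norms.L2Operator in
theorem eventually_hInfNorm_lt {nm τ : ℕ} {B : Fin τ → Matrix (Fin nm) (Fin nm) ℝ}
    (hB : ∀ θ, IsUnit (arChar B θ)) {ε : ℝ≥0∞} (hε : 0 < ε) :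
    ∀ᶠ C in 𝓝 B, hInfNorm (fun θ => arTF C θ - arTF B θ) < ε := by
  -- A bound strictly below `ε` is needed, since a supremum only preserves weak inequalities.
  obtain ⟨δ, hδ, hδε⟩ := ENNReal.lt_iff_exists_nnreal_btwn.1 hε
  have hδ' : (0 : ℝ) < δ := by exact_mod_cast hδ
  filter_upwards [eventually_arTF_sub_lt isCompact_Icc (fun θ _ => hB θ) continuous_l2_opNorm
    norm_zero hδ'] with C hC
  exact hInfNorm_lt_of_forall_norm_le (by simpa using hδε) fun θ hθ => (hC θ hθ).2.le

end LSAR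

end

/-! ### Transfer of consistency to the transfer function -/

theorem mainTheorem4
    {Ω : Type*} [MeasurableSpace Ω] (P : Measure Ω) [IsProbabilityMeasure P]
    (nm nl : ℕ)
    (A : Matrix (Fin nm ⊕ Fin nl) (Fin nm ⊕ Fin nl) ℝ)
    (hA : LSAR.SchurStable A)
    (hA22 : LSAR.SchurStable A.toBlocks₂₂)
    (τ22 : ℕ) (hτ22 : 1 ≤ τ22) (hnil : A.toBlocks₂₂ ^ τ22 = 0)
    (um : ℕ → Ω → Fin nm → ℝ) (hum : LSAR.IsWhiteInput P um)
    (x₀ : Ω → Fin nm ⊕ Fin nl → ℝ) (hx₀ : Measurable x₀)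
    (y : Ω → ℕ → Fin nm → ℝ) (hy : ∀ s, y s = LSAR.output A (x₀ s) (fun k => um k s))
    (τ : ℕ) (hτ : τ22 + 1 ≤ τ) :
    -- with probability tending to one, the estimated transfer function exists on the unit circle
    Tendsto (fun N : ℕ => P {s | ∃ θ ∈ Set.Icc (-Real.pi) Real.pi,
        ¬ IsUnit (LSAR.arChar (LSAR.lsarCoeff τ N (y s)) θ)}) atTop (𝓝 0) ∧
    -- entrywise convergence in probability at every frequency
    (∀ θ ∈ Set.Icc (-Real.pi) Real.pi, ∀ a b : Fin nm,
      TendstoInMeasure P (fun (N : ℕ) s => LSAR.arTF (LSAR.lsarCoeff τ N (y s)) θ a b) atTop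
        (fun _ => LSAR.manifestTF A θ a b)) ∧
    -- convergence in probability in the `H_∞`-norm
    (∀ ε : ℝ≥0∞, 0 < ε →
      Tendsto (fun N : ℕ => P {s | ε ≤ LSAR.hInfNorm (fun θ =>
        LSAR.arTF (LSAR.lsarCoeff τ N (y s)) θ - LSAR.manifestTF A θ)}) atTop (𝓝 0)) := by
  obtain ⟨t, rfl⟩ : ∃ t, τ = t + 1 := ⟨τ - 1, by omega⟩
  -- An order above `τ22 + 1` only appends zero coefficients to the same auto-regression.
  have ht : A.toBlocks₂₂ ^ t = 0 := pow_eq_zero_of_le (by omega) hnil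
  obtain rfl : y = fun s => LSAR.output A (x₀ s) fun k => um k s := funext hy
  have hlim := LSAR.tendsto_lsarCoeff_inProb hA hum hx₀ ht
  have hB : ∀ θ, IsUnit (LSAR.arChar (fun i : Fin (t + 1) => LSAR.manifestCoeff A i) θ) :=
    fun θ => (LSAR.isUnit_arChar_and_arTF_eq_manifestTF hA ht θ).1
  have hTF : ∀ θ, LSAR.arTF (fun i : Fin (t + 1) => LSAR.manifestCoeff A i) θ =
      LSAR.manifestTF A θ := fun θ => (LSAR.isUnit_arChar_and_arTF_eq_manifestTF hA ht θ).2
  refine ⟨?_, fun θ _ a b => ?_, fun ε hε => ?_⟩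
  · have h := hlim.eventually (LSAR.eventually_arTF_sub_lt (isCompact_Icc (a := -Real.pi)
      (b := Real.pi)) (fun θ _ => hB θ) continuous_const (g := fun _ => 0) rfl one_pos)
    have h1 := h.mono fun q hq θ hθ => (hq θ hθ).1
    rw [LSAR.eventually_inProb] at h1
    simpa only [not_forall, exists_prop] using h1
  · rw [LSAR.tendsto_inProb_iff, ← hTF]
    have h : ContinuousAt (fun C : Fin (t + 1) → Matrix (Fin nm) (Fin nm) ℝ => LSAR.arTF C θ)
        (fun i => LSAR.manifestCoeff A i) :=
      ContinuousAt.comp (f := fun C : Fin (t + 1) → Matrix (Fin nm) (Fin nm) ℝ => (C, θ))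
        (LSAR.continuousAt_arTF (q := (fun i => LSAR.manifestCoeff A i, θ)) (hB θ))
        (continuous_id.prodMk continuous_const).continuousAt
    exact ((continuous_apply b).comp (continuous_apply a)).continuousAt.tendsto.comp
      (h.tendsto.comp hlim)
  · have h := hlim.eventually (LSAR.eventually_hInfNorm_lt hB hε)
    rw [LSAR.eventually_inProb] at h
    simpa only [not_lt, hTF] using h
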